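/- **Setting.** Let $C\subseteq[0,1]$ be compact, let $\mathcal P$ be the set of Borel probability measures on $C$ with the Kolmogorov–Smirnov distance $D_\infty(\mu,\eta)=\sup_{t\in C}|F_\mu(t)-F_\eta(t)|$, and let $\rho:\mathcal P\to\mathbb R$ (a risk functional) be continuous for $D_\infty$. For a finite alphabet $\mathcal S=\{s_0,\dots,s_M\}\subset C$ of $M+1$ distinct points and $p$ in the simplex $\Delta^M=\{p\in[0,1]^{M+1}:\sum_i p_i=1\}$ put $\mathfrak D_{\mathcal S}(p)=\sum_i p_i\delta_{s_i}$ and $\mathcal P_{\mathcal S}=\mathfrak D_{\mathcal S}(\Delta^M)$, and let $$\mathcal K^{\rho}_{\inf}(\mu,r)=\inf\{\mathrm{KL}(\mu,\eta):\eta\in\mathcal P_{\mathcal S},\ \rho(\eta)\ge r\}\in[0,\infty].$$ Call $\rho$ *dominant on $\mathcal S$* if for every $\mu\in\mathcal P_{\mathcal S}$ and every $r\in\mathbb R$ for which $\{\eta\in\mathcal P_{\mathcal S}:\rho(\eta)\ge r\}\neq\emptyset$ there are $p^*\in\Delta^M$ with $\rho(\mathfrak D_{\mathcal S}(p^*))\ge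 r$ and $\mathrm{KL}(\mu,\mathfrak D_{\mathcal S}(p^*))=\mathcal K_{\inf}^\rho(\mu,r)$, and a set $\mathcal I\subset\{0,\dots,M\}$, neither empty nor full, such that $\rho(\mathfrak D_{\mathcal S}(q))\ge\rho(\mathfrak D_{\mathcal S}(p^*))$ for all $q\in\Delta^M$ with $q_i\le p^*_i$ for $i\in\mathcal I$ and $q_i\ge p_i^*$ for $i\notin\mathcal I$. Call $\rho$ *dominant* if it is dominant on every finite alphabet in $C$ with at least two points. **Algorithm.** Let $\nu=(\nu_1,\dots,\nu_K)$ be a bandit model with $K\ge1$ arms and $\nu_k\in\mathcal P_{\mathcal S}$. In $\rho$-MTS, in each round $t=1,2,\dots$ and given the past, one draws independently for each arm $k$ a vector $L_k^t\sim\mathrm{Dir}(1+T_k^0(t-1),\dots,1+T_k^M(t-1))$, where $T_k^i(t-1)$ is the number of earlier rounds in which arm $k$ was played and gave the reward $s_i$. One plays $A_t=t$ if $t\le K$, and otherwise some $A_t\in\arg\max_k\rho(\mathfrak D_{\mathcal S}(L_k^t))$ (ties broken in any way). Given the past, the samples of round $t$ and $A_t$, the reward is drawn from $\nu_{A_t}$.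 Write $r_k^\rho=\rho(\nu_k)$, $r_\star^\rho=\max_k r_k^\rho$, $\Delta_k^\rho=r_\star^\rho-r_k^\rho$, and let $\mathcal R_\nu^\rho(\rho\text{-MTS},n)=\mathbb E\big[\sum_{t=1}^n(r_\star^\rho-\rho(\nu_{A_t}))\big]$ be the $\rho$-risk regret. **Theorem.** Let $\rho$ be continuous and dominant and suppose that for the alphabet $\mathcal S$ the sets $\mathcal I$ can be chosen with $|\mathcal I|=M$. Then $\mathcal K_{\inf}^\rho(\nu_k,r_\star^\rho)>0$ for every $k$ with $\Delta_k^\rho>0$, and $$\mathcal R_\nu^\rho(\rho\text{-MTS},n)\le\sum_{k:\Delta_k^\rho>0}\frac{\Delta_k^\rho\,\log n}{\mathcal K_{\inf}^\rho(\nu_k,r_\star^\rho)}+o(\log n)\qquad(n\to\infty),$$ where a term with $\mathcal K_{\inf}^\rho(\nu_k,r_\star^\rho)=\infty$ is $0$. -/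

import Mathlib

open MeasureTheory ProbabilityTheory Filter
open scoped ENNReal

noncomputable section

namespace RiskMTS

/-- The probability simplex `Δ^M`: vectors `(p_0, …, p_M)` with nonnegative entries of sum `1`. -/
abbrev Simplex (M : ℕ) : Type := stdSimplex ℝ (Fin (M + 1))

section Risk

variable {C : Set ℝ}

/-- The Kolmogorov–Smirnov distance `sup_{t ∈ C} |F_μ(t) - F_η(t)|` of two laws on `C`. -/
def ksDist (μ η : ProbabilityMeasure C) : ℝ :=
  ⨆ t : C, |(μ : Measure C).real (Set.Iic t) - (η : Measure C).real (Set.Iic t)|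

/-- Continuity of a risk functional on all laws on `C`, for the Kolmogorov–Smirnov distance. -/
def KSContinuous (ρ : ProbabilityMeasure C → ℝ) : Prop :=
  ∀ μ : ProbabilityMeasure C, ∀ ε > 0, ∃ δ > 0, ∀ η : ProbabilityMeasure C,
    ksDist μ η < δ → |ρ μ - ρ η| < ε

variable {M : ℕ}

/-- The law `∑ i, p_i δ_{s_i}` on the alphabet `s_0, …, s_M`. -/
def discreteLaw (s : Fin (M + 1) → C) (p : Simplex M) : ProbabilityMeasure C :=
  ⟨∑ i, ENNReal.ofReal (p.1 i) • Measure.dirac (s i), ⟨by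
    have h := p.2.2
    simp only [Measure.coe_finsetSum, Measure.coe_smul, Finset.sum_apply, Pi.smul_apply,
      measure_univ, smul_eq_mul, mul_one]
    rw [← ENNReal.ofReal_sum_of_nonneg (fun i _ => p.2.1 i), h, ENNReal.ofReal_one]⟩⟩

/-- The set of all laws on the alphabet `s_0, …, s_M`. -/
def alphabetLaws (s : Fin (M + 1) → C) : Set (ProbabilityMeasure C) :=
  Set.range (discreteLaw s)

/-- `K_inf^ρ(μ, r)`: the infimum of `KL(μ, η)` over the laws `η` on the alphabet with
`ρ(η) ≥ r`, as an extended nonnegative real (`∞` when there is no such `η`). -/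
def Kinf (ρ : ProbabilityMeasure C → ℝ) (s : Fin (M + 1) → C) (μ : ProbabilityMeasure C)
    (r : ℝ) : ℝ≥0∞ :=
  ⨅ η ∈ {η ∈ alphabetLaws s | r ≤ ρ η}, InformationTheory.klDiv (μ : Measure C) (η : Measure C)

/-- The laws on the alphabet whose risk is at least that of `p`. -/
def upperRiskSet (ρ : ProbabilityMeasure C → ℝ) (s : Fin (M + 1) → C) (p : Simplex M) :
    Set (ProbabilityMeasure C) :=
  {μ ∈ alphabetLaws s | ρ (discreteLaw s p) ≤ ρ μ}

/-- The laws on the alphabet with `q_i ≤ p_i` for `i ∈ I` and `q_i ≥ p_i` for `i ∉ I`. -/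
def orthantSet (s : Fin (M + 1) → C) (p : Simplex M) (I : Finset (Fin (M + 1))) :
    Set (ProbabilityMeasure C) :=
  discreteLaw s '' {q | (∀ i ∈ I, q.1 i ≤ p.1 i) ∧ ∀ i ∉ I, p.1 i ≤ q.1 i}

/-- Dominance of `ρ` on one alphabet: for every law `μ` on the alphabet and every level `r` that
`ρ` reaches on the alphabet, the infimum in `K_inf^ρ(μ, r)` is attained at some `p'` (a law on the
alphabet with `ρ ≥ r`), and for some index set `I`, neither empty nor full and subject
to the requirement `Q I`, the orthant-like region at `p'` given by `I` lies in the region where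
the risk is at least that of `p'`. -/
def DominantOn (ρ : ProbabilityMeasure C → ℝ) (s : Fin (M + 1) → C)
    (Q : Finset (Fin (M + 1)) → Prop) : Prop :=
  ∀ μ ∈ alphabetLaws s, ∀ r : ℝ, (∃ η ∈ alphabetLaws s, r ≤ ρ η) →
    ∃ p' : Simplex M, r ≤ ρ (discreteLaw s p') ∧
      Kinf ρ s μ r
        = InformationTheory.klDiv (μ : Measure C) (discreteLaw s p' : Measure C) ∧
      ∃ I : Finset (Fin (M + 1)), I ≠ ∅ ∧ I ≠ Finset.univ ∧ Q I ∧
        orthantSet s p' I ⊆ upperRiskSet ρ s p'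

/-- A dominant risk functional: dominance on every finite alphabet in `C` with at least two
letters. -/
def Dominant (ρ : ProbabilityMeasure C → ℝ) : Prop :=
  ∀ (m : ℕ), 1 ≤ m → ∀ s : Fin (m + 1) → C, Function.Injective s →
    DominantOn ρ s (fun _ => True)

end Risk

section Dirichlet

variable {M : ℕ}

/-- Lebesgue measure on `Δ^M` in the coordinates `(x_1, …, x_M)`, `x_0 = 1 - x_1 - … - x_M`. -/
def simplexVolume (M : ℕ) : Measure (Simplex M) :=
  Measure.comap (fun (x : Simplex M) (i : Fin M) => x.1 i.succ) volume

/-- The density `Γ(∑ α_i) / ∏ Γ(α_i) * ∏ x_i ^ (α_i - 1)`. -/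
def dirichletDensity (α : Fin (M + 1) → ℝ) (x : Simplex M) : ℝ :=
  Real.Gamma (∑ i, α i) / (∏ i, Real.Gamma (α i)) * ∏ i, x.1 i ^ (α i - 1)

/-- The Dirichlet distribution `Dir(α)` on the simplex. -/
def dirichlet (α : Fin (M + 1) → ℝ) : Measure (Simplex M) :=
  (simplexVolume M).withDensity fun x => ENNReal.ofReal (dirichletDensity α x)

end Dirichlet

section Bandit

variable {C : Set ℝ} {M K : ℕ} {Ω : Type*}

/-- The number of rounds, among the first `t`, in which arm `k` was played and the reward was
`s_i`. Rounds are numbered `0, 1, 2, …`. -/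
def rewardCount (s : Fin (M + 1) → C) (A : ℕ → Ω → Fin K) (X : ℕ → Ω → C) (t : ℕ) (ω : Ω)
    (k : Fin K) (i : Fin (M + 1)) : ℕ :=
  Set.ncard {u : ℕ | u < t ∧ A u ω = k ∧ X u ω = s i}

/-- The parameter of the Dirichlet posterior of arm `k` after the first `t` rounds, for the uniform
prior `Dir(1, …, 1)`. -/
def posteriorParam (s : Fin (M + 1) → C) (A : ℕ → Ω → Fin K) (X : ℕ → Ω → C) (t : ℕ) (ω : Ω)
    (k : Fin K) (i : Fin (M + 1)) : ℝ :=
  1 + (rewardCount s A X t ω k i : ℝ)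

/-- `IsRhoMTS ρ s ν P 𝓕 L A X`: under `P`, the posterior samples `L`, the arms `A` and the rewards
`X` form a run of `ρ`-MTS with alphabet `s` on the bandit model `ν`. Here `𝓕 t` is the information
available before round `t`, and rounds are numbered `0, 1, 2, …`. -/
structure IsRhoMTS [mΩ : MeasurableSpace Ω] (ρ : ProbabilityMeasure C → ℝ)
    (s : Fin (M + 1) → C) (ν : Fin K → ProbabilityMeasure C) (P : Measure Ω)
    (𝓕 : Filtration ℕ mΩ) (L : ℕ → Ω → Fin K → Simplex M) (A : ℕ → Ω → Fin K)
    (X : ℕ → Ω → C) : Prop where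
  measurable_sample : ∀ t, Measurable[𝓕 (t + 1)] (L t)
  measurable_arm : ∀ t, Measurable[𝓕 (t + 1)] (A t)
  measurable_reward : ∀ t, Measurable[𝓕 (t + 1)] (X t)
  /-- Given the past, the samples of round `t` are independent over the arms, the one of arm `k`
  being drawn from the current Dirichlet posterior of arm `k`. -/
  sample_law : ∀ t, ∀ B : Fin K → Set (Simplex M), (∀ k, MeasurableSet (B k)) →
    P⟦{ω | ∀ k, L t ω k ∈ B k} | 𝓕 t⟧
      =ᵐ[P] fun ω => ∏ k, (dirichlet (posteriorParam s A X t ω k)).real (B k)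
  /-- In the first `K` rounds every arm is played once, in order. -/
  arm_init : ∀ t (ht : t < K), ∀ᵐ ω ∂P, A t ω = ⟨t, ht⟩
  /-- In each later round an arm with the largest sampled risk is played; ties may be broken in any
  way. -/
  arm_argmax : ∀ t, K ≤ t → ∀ᵐ ω ∂P, ∀ k,
    ρ (discreteLaw s (L t ω k)) ≤ ρ (discreteLaw s (L t ω (A t ω)))
  /-- Given the past, the samples and the chosen arm, the reward is drawn from the law of the
  chosen arm. -/
  reward_law : ∀ t, ∀ B : Set C, MeasurableSet B →
    P⟦X t ⁻¹' B | 𝓕 t ⊔ MeasurableSpace.comap (L t) inferInstance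
        ⊔ MeasurableSpace.comap (A t) inferInstance⟧
      =ᵐ[P] fun ω => (ν (A t ω) : Measure C).real B

/-- The largest risk `max_k ρ(ν_k)` of an arm. -/
def bestRisk (ρ : ProbabilityMeasure C → ℝ) (ν : Fin K → ProbabilityMeasure C) : ℝ :=
  ⨆ k, ρ (ν k)

/-- The gap `Δ_k = max_j ρ(ν_j) - ρ(ν_k)` of arm `k`. -/
def gap (ρ : ProbabilityMeasure C → ℝ) (ν : Fin K → ProbabilityMeasure C) (k : Fin K) : ℝ :=
  bestRisk ρ ν - ρ (ν k)

/-- The `ρ`-risk regret after `n` rounds. -/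
def regret [MeasurableSpace Ω] (ρ : ProbabilityMeasure C → ℝ) (ν : Fin K → ProbabilityMeasure C)
    (P : Measure Ω) (A : ℕ → Ω → Fin K) (n : ℕ) : ℝ :=
  ∫ ω, ∑ t ∈ Finset.range n, (bestRisk ρ ν - ρ (ν (A t ω))) ∂P

end Bandit

end RiskMTS

end

open RiskMTS

/-!
The regret is the sum over the arms of the gap times the expected number of plays, so it is enough
to show that a suboptimal arm `k` is played at most `log N / a + O(1)` times on average during the
first `N` rounds, for every `a < K_inf(ν_k, r)` with `r` the largest risk
(`IsRhoMTS.exists_sum_plays_le`). Apart from the initial rounds, the plays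
of arm `k` are of three kinds.

* The largest sampled risk is at most a level `y < r`. Given the past, the probability of such a
  round is the posterior odds of the event that the sample of an optimal arm `j` has risk at most
  `y`, times the probability of a round in which that sample alone exceeds `y`; in the latter, arm
  `j` is played. Hence the expected number of such rounds is at most a sum, over the letter counts
  `c`, of the posterior odds at `c` times the expected number of plays of arm `j` at counts `c`
  (`IsRhoMTS.exists_sum_sample_le_le`). Each term is exponentially small in the sample size
  (`exists_posteriorRatio_mul_le_exp`).
* The empirical law of arm `k` is away from `ν_k`. This has a summable probability
  (`IsRhoMTS.exists_sum_far_le`).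
* The empirical law of arm `k` is close to `ν_k`, but its sample has risk above `y`. Once arm `k`
  has `n` observations, this has probability of order `exp (-n a)` if `y` is close to `r`
  (`IsRhoMTS.exists_sum_near_le`), because `K_inf` is lower semicontinuous in the law and in the
  level (`exists_likelihood_le_of_lt_Kinf`, by compactness of the simplex). With
  `n ≥ log N / a` observations it is of order `1 / N` in each round, and at most `log N / a + 1`
  plays occur before.

Everything is expressed through the likelihood `∏ x_i ^ c_i` of the letter counts. The Dirichlet
posterior has a density proportional to it, so a ratio of two posterior probabilities is bounded by
the largest likelihood on one set and the likelihood on a small homothetic copy of the simplex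
inside the other (`posteriorRatio_mul_le`): neither the normalising constant nor the volume of the
simplex is needed. Likewise the expected number of plays of an arm at counts `c` is at most the
likelihood ratio of the law of the arm to any other law
(`IsRhoMTS.sum_visits_mul_likelihood_le`), by a recursion on `c`. The exponential bounds all come
from one inequality, `likelihood_le_exp_mul_mix`.

The positivity of `K_inf` follows from the infimum being attained, which is part of dominance
(`DominantOn.Kinf_pos`).
-/

namespace RiskMTS

open Topology

/-! ### Likelihoods on the simplex -/

section Simplex

variable {M : ℕ}

/-- The likelihood `∏ x_i ^ c_i` of a sample with `c_i` occurrences of the letter `i`, when the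
letters are drawn independently from `x` (the multinomial coefficient is left out). -/
noncomputable def likelihood (c : Fin (M + 1) → ℕ) (x : Simplex M) : ℝ := ∏ i, x.1 i ^ c i

lemma likelihood_nonneg (c : Fin (M + 1) → ℕ) (x : Simplex M) : 0 ≤ likelihood c x :=
  Finset.prod_nonneg fun i _ => pow_nonneg (x.2.1 i) _

lemma Simplex.le_one (x : Simplex M) (i : Fin (M + 1)) : x.1 i ≤ 1 :=
  x.2.2 ▸ Finset.single_le_sum (fun j _ => x.2.1 j) (Finset.mem_univ i)

lemma likelihood_pos {c : Fin (M + 1) → ℕ} {x : Simplex M} (h : ∀ i, c i ≠ 0 → 0 < x.1 i) :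
    0 < likelihood c x := by
  refine Finset.prod_pos fun i _ => ?_
  by_cases hc : c i = 0
  · simp [hc]
  · exact pow_pos (h i hc) _

/-- The point `(1 - θ) x + θ z` of the simplex. -/
noncomputable def mix (θ : unitInterval) (x z : Simplex M) : Simplex M :=
  ⟨fun i => (1 - θ) * x.1 i + θ * z.1 i, fun i => add_nonneg
    (mul_nonneg (sub_nonneg.2 θ.2.2) (x.2.1 i)) (mul_nonneg θ.2.1 (z.2.1 i)), by
    rw [Finset.sum_add_distrib, ← Finset.mul_sum, ← Finset.mul_sum, x.2.2, z.2.2]; ring⟩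

lemma dist_mix_le (θ : unitInterval) (x z : Simplex M) : dist (mix θ x z) x ≤ θ := by
  rw [Subtype.dist_eq, dist_pi_le_iff θ.2.1]
  intro i
  rw [Real.dist_eq, abs_le]
  have h1 := x.2.1 i
  have h2 := z.2.1 i
  have h3 := x.le_one i
  have h4 := z.le_one i
  have h5 := θ.2.1
  simp only [mix]
  constructor <;> nlinarith

lemma likelihood_mix_ge (c : Fin (M + 1) → ℕ) (θ : unitInterval) (x z : Simplex M) :
    (1 - θ : ℝ) ^ (∑ i, c i) * likelihood c x ≤ likelihood c (mix θ x z) := by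
  have h5 := sub_nonneg.2 θ.2.2
  rw [likelihood, ← Finset.prod_pow_eq_pow_sum, ← Finset.prod_mul_distrib]
  refine Finset.prod_le_prod
    (fun i _ => mul_nonneg (pow_nonneg h5 _) (pow_nonneg (x.2.1 i) _)) fun i _ => ?_
  rw [← mul_pow]
  refine pow_le_pow_left₀ (mul_nonneg h5 (x.2.1 i)) ?_ _
  exact le_add_of_nonneg_right (mul_nonneg θ.2.1 (z.2.1 i))

lemma exists_empirical (c : Fin (M + 1) → ℕ) :
    ∃ μ : Simplex M, ∀ i, (c i : ℝ) = (∑ j, c j : ℕ) * μ.1 i := by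
  by_cases h : ∑ j, c j = 0
  · obtain ⟨μ⟩ : Nonempty (Simplex M) := inferInstance
    refine ⟨μ, fun i => ?_⟩
    have := (Finset.sum_eq_zero_iff.1 h) i (Finset.mem_univ i)
    simp [h, this]
  · have h' : ((∑ j, c j : ℕ) : ℝ) ≠ 0 := by exact_mod_cast h
    refine ⟨⟨fun i => c i / (∑ j, c j : ℕ), fun i => by positivity, ?_⟩, fun i => ?_⟩
    · rw [← Finset.sum_div, ← Nat.cast_sum, div_self h']
    · exact (mul_div_cancel₀ _ h').symm

/-- The empirical law of a sample with letter counts `c`; an arbitrary point of the simplex when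
the sample is empty. -/
noncomputable def empirical (c : Fin (M + 1) → ℕ) : Simplex M := (exists_empirical c).choose

lemma natCast_eq_mul_empirical (c : Fin (M + 1) → ℕ) (i : Fin (M + 1)) :
    (c i : ℝ) = (∑ j, c j : ℕ) * (empirical c).1 i :=
  (exists_empirical c).choose_spec i

lemma empirical_pos {c : Fin (M + 1) → ℕ} {i : Fin (M + 1)} (h : c i ≠ 0) :
    0 < (empirical c).1 i := by
  refine ((empirical c).2.1 i).lt_of_ne fun h0 => h ?_
  have := natCast_eq_mul_empirical c i
  rw [← h0, mul_zero] at this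
  exact_mod_cast this

lemma likelihood_empirical_pos (c : Fin (M + 1) → ℕ) : 0 < likelihood c (empirical c) :=
  likelihood_pos fun _ => empirical_pos

lemma likelihood_eq_rpow (c : Fin (M + 1) → ℕ) (x : Simplex M) :
    likelihood c x = (∏ i, x.1 i ^ (empirical c).1 i) ^ (∑ i, c i) := by
  rw [likelihood, ← Finset.prod_pow]
  refine Finset.prod_congr rfl fun i _ => ?_
  rw [← Real.rpow_natCast, ← Real.rpow_natCast, ← Real.rpow_mul (x.2.1 i), mul_comm,
    ← natCast_eq_mul_empirical]

/-- Moving a law towards the empirical law increases the likelihood exponentially fast in the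
sample size, at a rate that is quadratic in the distance to the empirical law. -/
lemma likelihood_le_exp_mul_mix (c : Fin (M + 1) → ℕ) (l : unitInterval) (hl : 0 < (l : ℝ))
    (x : Simplex M) :
    likelihood c x ≤ Real.exp (-((∑ i, c i : ℕ) * (l * (1 - l) * dist (empirical c) x ^ 2))) *
      likelihood c (mix l x (empirical c)) := by
  set μ := empirical c with hμ
  set y := mix l x μ with hy
  have hl1 : 0 ≤ 1 - (l : ℝ) := sub_nonneg.2 l.2.2
  have hyi : ∀ i, y.1 i = (1 - l) * x.1 i + l * μ.1 i := fun i => rfl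
  have hypos : ∀ i, c i ≠ 0 → 0 < y.1 i := fun i hi => by
    rw [hyi]
    have := mul_pos hl (empirical_pos hi)
    have := mul_nonneg hl1 (x.2.1 i)
    linarith
  -- each factor is bounded through `u ≤ exp (u - 1)` at `u = x_i / y_i`
  have h1 : likelihood c x ≤
      ∏ i, (Real.exp ((c i : ℝ) * (x.1 i / y.1 i - 1)) * y.1 i ^ c i) := by
    refine Finset.prod_le_prod (fun i _ => pow_nonneg (x.2.1 i) _) fun i _ => ?_
    by_cases hc : c i = 0
    · simp [hc]
    · have hyp := hypos i hc
      rw [Real.exp_nat_mul, ← mul_pow]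
      refine pow_le_pow_left₀ (x.2.1 i) ?_ _
      have h2 : x.1 i / y.1 i ≤ Real.exp (x.1 i / y.1 i - 1) := by
        have := Real.add_one_le_exp (x.1 i / y.1 i - 1)
        linarith
      exact (div_le_iff₀ hyp).1 h2
  refine h1.trans ?_
  rw [Finset.prod_mul_distrib, ← Real.exp_sum]
  refine mul_le_mul_of_nonneg_right (Real.exp_le_exp.2 ?_) (likelihood_nonneg c y)
  have h3 : ∑ i, (c i : ℝ) * (x.1 i / y.1 i - 1) ≤
      ∑ i, ((∑ j, c j : ℕ) : ℝ) *
        ((l : ℝ) * (x.1 i - μ.1 i) - l * (1 - l) * (μ.1 i - x.1 i) ^ 2) := by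
    refine Finset.sum_le_sum fun i _ => ?_
    rw [natCast_eq_mul_empirical c i, mul_assoc]
    refine mul_le_mul_of_nonneg_left ?_ (Nat.cast_nonneg _)
    rw [← hμ]
    rcases (y.2.1 i).eq_or_lt with h0 | hp
    · have ha := mul_nonneg hl1 (x.2.1 i)
      have hb := mul_nonneg hl.le (μ.2.1 i)
      have hz : l * μ.1 i = 0 := by have := hyi i; linarith
      have hμ0 : μ.1 i = 0 := (mul_eq_zero.1 hz).resolve_left hl.ne'
      have hz2 : (1 - l) * x.1 i = 0 := by have := hyi i; linarith
      rw [hμ0]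
      have : l * (1 - l) * (0 - x.1 i) ^ 2 = l * x.1 i * ((1 - l) * x.1 i) := by ring
      rw [this, hz2]
      have := mul_nonneg hl.le (x.2.1 i)
      simpa using this
    · have e1 : μ.1 i * (x.1 i / y.1 i - 1) =
          l * (x.1 i - μ.1 i) - l * (1 - l) * ((μ.1 i - x.1 i) ^ 2 / y.1 i) := by
        field_simp
        rw [hyi]; ring
      rw [e1]
      have e2 : (μ.1 i - x.1 i) ^ 2 ≤ (μ.1 i - x.1 i) ^ 2 / y.1 i :=
        le_div_self (sq_nonneg _) hp (y.le_one i)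
      have := mul_le_mul_of_nonneg_left e2 (mul_nonneg hl.le hl1)
      linarith
  refine h3.trans ?_
  rw [← Finset.mul_sum, ← mul_neg]
  refine mul_le_mul_of_nonneg_left ?_ (Nat.cast_nonneg _)
  rw [Finset.sum_sub_distrib, ← Finset.mul_sum, ← Finset.mul_sum, Finset.sum_sub_distrib, x.2.2,
    μ.2.2]
  have h4 : dist μ x ^ 2 ≤ ∑ i, (μ.1 i - x.1 i) ^ 2 := by
    have h5 : dist μ x ≤ Real.sqrt (∑ i, (μ.1 i - x.1 i) ^ 2) := by
      rw [Subtype.dist_eq, dist_pi_le_iff (Real.sqrt_nonneg _)]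
      intro i
      rw [Real.dist_eq]
      exact Real.abs_le_sqrt (Finset.single_le_sum (f := fun i => (μ.1 i - x.1 i) ^ 2)
        (fun j _ => sq_nonneg _) (Finset.mem_univ i))
    calc dist μ x ^ 2 ≤ Real.sqrt (∑ i, (μ.1 i - x.1 i) ^ 2) ^ 2 :=
          pow_le_pow_left₀ dist_nonneg h5 2
      _ = _ := Real.sq_sqrt (Finset.sum_nonneg fun i _ => sq_nonneg _)
  have := mul_le_mul_of_nonneg_left h4 (mul_nonneg hl.le hl1)
  linarith

/-- The empirical law maximises the likelihood. -/
lemma likelihood_le_empirical (c : Fin (M + 1) → ℕ) (x : Simplex M) :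
    likelihood c x ≤ likelihood c (empirical c) := by
  have h := likelihood_le_exp_mul_mix c 1 one_pos x
  have e : mix 1 x (empirical c) = empirical c := Subtype.ext (funext fun i => by simp [mix])
  simpa [e] using h

/-- The likelihood of a law away from the empirical law is exponentially small compared with the
maximal one. -/
lemma likelihood_le_exp_mul_empirical (c : Fin (M + 1) → ℕ) (x : Simplex M) {d : ℝ} (hd : 0 ≤ d)
    (h : d ≤ dist (empirical c) x) :
    likelihood c x ≤
      Real.exp (-((∑ i, c i : ℕ) * (d ^ 2 / 4))) * likelihood c (empirical c) := by
  have hhalf : (1 / 2 : ℝ) ∈ unitInterval := ⟨by norm_num, by norm_num⟩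
  refine (likelihood_le_exp_mul_mix c ⟨1 / 2, hhalf⟩ (by norm_num) x).trans ?_
  refine mul_le_mul (Real.exp_le_exp.2 ?_) (likelihood_le_empirical c _)
    (likelihood_nonneg _ _) (Real.exp_pos _).le
  rw [neg_le_neg_iff]
  refine mul_le_mul_of_nonneg_left ?_ (Nat.cast_nonneg _)
  have := pow_le_pow_left₀ hd h 2
  norm_num
  linarith

/-- A geometric series over all count vectors. -/
lemma sum_exp_neg_mul_sum_le {κ : ℝ} (hκ : 0 < κ) (N : ℕ) :
    ∑ c ∈ Fintype.piFinset fun _ : Fin (M + 1) => Finset.range N,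
      Real.exp (-((∑ i, c i : ℕ) * κ)) ≤ ((1 - Real.exp (-κ))⁻¹) ^ (M + 1) := by
  have h1 : Real.exp (-κ) < 1 := by rw [Real.exp_lt_one_iff]; linarith
  have e : ∀ c : Fin (M + 1) → ℕ,
      Real.exp (-((∑ i, c i : ℕ) * κ)) = ∏ i, Real.exp (-κ) ^ c i := fun c => by
    rw [Finset.prod_pow_eq_pow_sum, ← Real.exp_nat_mul, mul_neg]
  simp_rw [e]
  rw [← Finset.prod_univ_sum (fun _ : Fin (M + 1) => Finset.range N)
    (fun _ m => Real.exp (-κ) ^ m), Finset.prod_const, Finset.card_univ, Fintype.card_fin]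
  refine pow_le_pow_left₀ (Finset.sum_nonneg fun _ _ => by positivity) ?_ _
  rw [← tsum_geometric_of_lt_one (Real.exp_pos _).le h1]
  exact (summable_geometric_of_lt_one (Real.exp_pos _).le h1).sum_le_tsum _
    fun _ _ => by positivity

end Simplex

/-! ### Laws on the alphabet: continuity of the risk and semicontinuity of the divergence -/

section Alphabet

variable {C : Set ℝ} {M : ℕ}

lemma discreteLaw_apply (s : Fin (M + 1) → C) (p : Simplex M) (B : Set C) :
    (discreteLaw s p : Measure C) B = ∑ i, ENNReal.ofReal (p.1 i) * B.indicator 1 (s i) := by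
  simp [discreteLaw]

open Classical in
lemma discreteLaw_real (s : Fin (M + 1) → C) (p : Simplex M) (B : Set C) :
    (discreteLaw s p : Measure C).real B = ∑ i, if s i ∈ B then p.1 i else 0 := by
  rw [Measure.real, discreteLaw_apply, ENNReal.toReal_sum]
  · refine Finset.sum_congr rfl fun i _ => ?_
    by_cases h : s i ∈ B <;> simp [h, p.2.1 i]
  · intro i _
    by_cases h : s i ∈ B <;> simp [h]

lemma discreteLaw_real_singleton {s : Fin (M + 1) → C} (hs : Function.Injective s)
    (p : Simplex M) (i : Fin (M + 1)) : (discreteLaw s p : Measure C).real {s i} = p.1 i := by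
  classical
  rw [discreteLaw_real]
  simp [hs.eq_iff]

lemma ksDist_discreteLaw_le (s : Fin (M + 1) → C) (p q : Simplex M) :
    ksDist (discreteLaw s p) (discreteLaw s q) ≤ (M + 1) * dist p q := by
  classical
  have : Nonempty C := ⟨s 0⟩
  refine ciSup_le fun t => ?_
  rw [discreteLaw_real, discreteLaw_real, ← Finset.sum_sub_distrib]
  refine (Finset.abs_sum_le_sum_abs _ _).trans ?_
  have h : ∀ i ∈ Finset.univ, |(if s i ∈ Set.Iic t then p.1 i else 0) -
      (if s i ∈ Set.Iic t then q.1 i else 0)| ≤ dist p q := fun i _ => by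
    split_ifs
    · exact (Real.dist_eq _ _).symm.trans_le (dist_le_pi_dist p.1 q.1 i)
    · simp
  simpa using Finset.sum_le_card_nsmul _ _ _ h

lemma KSContinuous.continuous_risk {ρ : ProbabilityMeasure C → ℝ} (hρ : KSContinuous ρ)
    (s : Fin (M + 1) → C) : Continuous fun p : Simplex M => ρ (discreteLaw s p) := by
  rw [Metric.continuous_iff']
  intro p ε hε
  obtain ⟨δ, hδ, h⟩ := hρ (discreteLaw s p) ε hε
  have h0 : (0 : ℝ) < M + 1 := by positivity
  filter_upwards [Metric.ball_mem_nhds p (div_pos hδ h0)] with q hq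
  rw [dist_comm, Real.dist_eq]
  refine h _ ((ksDist_discreteLaw_le s p q).trans_lt ?_)
  rw [mul_comm, ← lt_div_iff₀ h0, dist_comm]
  exact hq

/-- A likelihood-ratio form of the finite-alphabet formula `KL(p, q) = ∑ p_i log (p_i / q_i)`. -/
lemma klDiv_discreteLaw_le {s : Fin (M + 1) → C} (hs : Function.Injective s) {p q : Simplex M}
    {a : ℝ} (h : Real.exp (-a) * ∏ i, p.1 i ^ p.1 i ≤ ∏ i, q.1 i ^ p.1 i) :
    InformationTheory.klDiv (discreteLaw s p : Measure C) (discreteLaw s q : Measure C)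
      ≤ ENNReal.ofReal a := by
  classical
  have hp0 : ∀ i, 0 < p.1 i ^ p.1 i := fun i => by
    rcases (p.2.1 i).eq_or_lt with h0 | h0
    · rw [← h0]; simp
    · exact Real.rpow_pos_of_pos h0 _
  have hq0 : ∀ i, 0 < p.1 i → 0 < q.1 i := fun i hi => by
    refine (q.2.1 i).lt_of_ne fun h0 => ?_
    have : ∏ i, q.1 i ^ p.1 i = 0 :=
      Finset.prod_eq_zero (Finset.mem_univ i) (by rw [← h0, Real.zero_rpow hi.ne'])
    rw [this] at h
    have := mul_pos (Real.exp_pos (-a))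
      (Finset.prod_pos fun i (_ : i ∈ Finset.univ) => hp0 i)
    linarith
  set f : C → ℝ≥0∞ := fun z => ∑ i, ({s i} : Set C).indicator
    (fun _ => ENNReal.ofReal (p.1 i / q.1 i)) z with hf
  have hfm : Measurable f := Finset.measurable_sum _ fun i _ =>
    measurable_const.indicator (measurableSet_singleton _)
  have hfs : ∀ i, f (s i) = ENNReal.ofReal (p.1 i / q.1 i) := fun i => by
    simp only [hf]
    rw [Finset.sum_eq_single i]
    · simp
    · intro j _ hj
      simp [hs.eq_iff, hj.symm]
    · simp
  have hwd : (discreteLaw s p : Measure C) = (discreteLaw s q : Measure C).withDensity f := by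
    ext B hB
    rw [withDensity_apply _ hB, ← lintegral_indicator hB, discreteLaw_apply]
    simp only [discreteLaw, ProbabilityMeasure.coe_mk, lintegral_finsetSum_measure,
      lintegral_smul_measure, lintegral_dirac]
    refine Finset.sum_congr rfl fun i _ => ?_
    by_cases hi : s i ∈ B
    · simp only [hi, Set.indicator_of_mem, Pi.one_apply, mul_one, hfs, smul_eq_mul]
      rw [← ENNReal.ofReal_mul (q.2.1 i)]
      rcases (p.2.1 i).eq_or_lt with h0 | h0
      · simp [← h0]
      · rw [mul_div_cancel₀ _ (hq0 i h0).ne']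
    · simp [hi]
  have hac : (discreteLaw s p : Measure C) ≪ (discreteLaw s q : Measure C) :=
    hwd ▸ withDensity_absolutelyContinuous _ _
  have hllr : llr (discreteLaw s p : Measure C) (discreteLaw s q : Measure C)
      =ᵐ[(discreteLaw s p : Measure C)] fun z => Real.log (f z).toReal := by
    refine hac.ae_le ?_
    have := Measure.rnDeriv_withDensity (discreteLaw s q : Measure C) hfm
    rw [← hwd] at this
    filter_upwards [this] with z hz
    rw [llr, hz]
  have hint : ∀ g : C → ℝ, Integrable g (discreteLaw s p : Measure C) := fun g => by
    simp only [discreteLaw, ProbabilityMeasure.coe_mk, integrable_finsetSum_measure]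
    exact fun i _ => (integrable_dirac (by finiteness)).smul_measure ENNReal.ofReal_ne_top
  have hval : ∀ g : C → ℝ, ∫ z, g z ∂(discreteLaw s p : Measure C) = ∑ i, p.1 i * g (s i) :=
    fun g => by
    simp only [discreteLaw, ProbabilityMeasure.coe_mk]
    rw [integral_finsetSum_measure fun i _ =>
      (integrable_dirac (by finiteness)).smul_measure ENNReal.ofReal_ne_top]
    refine Finset.sum_congr rfl fun i _ => ?_
    rw [integral_smul_measure, integral_dirac, ENNReal.toReal_ofReal (p.2.1 i), smul_eq_mul]
  rw [InformationTheory.klDiv_of_ac_of_integrable hac ((integrable_congr hllr).2 (hint _)),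
    integral_congr_ae hllr, hval]
  refine ENNReal.ofReal_le_ofReal ?_
  simp only [probReal_univ, add_sub_cancel_right, hfs]
  have hterm : ∀ i, p.1 i * Real.log (ENNReal.ofReal (p.1 i / q.1 i)).toReal =
      Real.log (p.1 i ^ p.1 i) - Real.log (q.1 i ^ p.1 i) := fun i => by
    rcases (p.2.1 i).eq_or_lt with h0 | h0
    · simp [← h0]
    · have h1 := hq0 i h0
      rw [ENNReal.toReal_ofReal (by positivity), Real.log_div h0.ne' h1.ne', Real.log_rpow h0,
        Real.log_rpow h1]
      ring
  have hqp : ∀ i, 0 < q.1 i ^ p.1 i := fun i => by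
    rcases (p.2.1 i).eq_or_lt with h0 | h0
    · simp [← h0]
    · exact Real.rpow_pos_of_pos (hq0 i h0) _
  rw [Finset.sum_congr rfl fun i _ => hterm i, Finset.sum_sub_distrib,
    ← Real.log_prod fun i _ => (hp0 i).ne', ← Real.log_prod fun i _ => (hqp i).ne']
  have hP := Finset.prod_pos fun i (_ : i ∈ Finset.univ) => hp0 i
  have := Real.log_le_log (mul_pos (Real.exp_pos _) hP) h
  rw [Real.log_mul (Real.exp_pos _).ne' hP.ne', Real.log_exp] at this
  linarith

lemma continuous_prod_rpow_self :
    Continuous fun p : Simplex M => ∏ i, p.1 i ^ p.1 i := by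
  have e : (fun p : Simplex M => ∏ i, p.1 i ^ p.1 i) =
      fun p => ∏ i, Real.exp (p.1 i * Real.log (p.1 i)) := by
    funext p
    refine Finset.prod_congr rfl fun i _ => ?_
    rcases (p.2.1 i).eq_or_lt with h0 | h0
    · simp [← h0]
    · rw [Real.rpow_def_of_pos h0, mul_comm]
  rw [e]
  refine continuous_finsetProd _ fun i _ => Real.continuous_exp.comp ?_
  exact Real.continuous_mul_log.comp ((continuous_apply i).comp continuous_subtype_val)

/-- Joint lower semicontinuity of `K_inf` in the law and in the level, in terms of likelihoods:
for `a < K_inf(p, r)`, all laws whose risk is above a level slightly below `r` have likelihood at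
most `exp (-n a)` times the maximal one for every sample with empirical law close to `p`. -/
lemma exists_likelihood_le_of_lt_Kinf {ρ : ProbabilityMeasure C → ℝ} (hρ : KSContinuous ρ)
    {s : Fin (M + 1) → C} (hs : Function.Injective s) {p : Simplex M} {r a : ℝ}
    (ha : ENNReal.ofReal a < Kinf ρ s (discreteLaw s p) r) :
    ∃ ε > 0, ∀ c : Fin (M + 1) → ℕ, dist (empirical c) p < ε → ∀ x : Simplex M,
      r - ε < ρ (discreteLaw s x) →
      likelihood c x ≤ Real.exp (-((∑ i, c i : ℕ) * a)) * likelihood c (empirical c) := by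
  classical
  suffices H : ∃ ε > 0, ∀ μ : Simplex M, dist μ p < ε → ∀ x : Simplex M,
      r - ε < ρ (discreteLaw s x) →
      ∏ i, x.1 i ^ μ.1 i ≤ Real.exp (-a) * ∏ i, μ.1 i ^ μ.1 i by
    obtain ⟨ε, hε, H⟩ := H
    refine ⟨ε, hε, fun c hc x hx => ?_⟩
    rw [likelihood_eq_rpow, likelihood_eq_rpow c (empirical c), ← mul_neg, Real.exp_nat_mul,
      ← mul_pow]
    exact pow_le_pow_left₀ (Finset.prod_nonneg fun i _ => Real.rpow_nonneg (x.2.1 i) _)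
      (H _ hc x hx) _
  by_contra! hcon
  have hpos : ∀ n : ℕ, (0 : ℝ) < 1 / (n + 1) := fun n => by positivity
  choose μ hμ x hx hlt using fun n : ℕ => hcon (1 / (n + 1)) (hpos n)
  obtain ⟨y, φ, hφ, hy⟩ := CompactSpace.tendsto_subseq x
  have hlim : Tendsto (fun n => 1 / ((φ n : ℝ) + 1)) atTop (𝓝 0) :=
    (tendsto_one_div_add_atTop_nhds_zero_nat (𝕜 := ℝ)).comp hφ.tendsto_atTop
  have hμp : Tendsto (μ ∘ φ) atTop (𝓝 p) := by
    rw [tendsto_iff_dist_tendsto_zero]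
    exact squeeze_zero (fun _ => dist_nonneg) (fun n => (hμ (φ n)).le) hlim
  have hry : r ≤ ρ (discreteLaw s y) := by
    have h1 : Tendsto (fun n => r - 1 / ((φ n : ℝ) + 1)) atTop (𝓝 (r - 0)) :=
      tendsto_const_nhds.sub hlim
    rw [sub_zero] at h1
    exact le_of_tendsto_of_tendsto' h1 (((hρ.continuous_risk s).tendsto y).comp hy)
      fun n => (hx (φ n)).le
  have hcoord : ∀ (u : ℕ → Simplex M) (v : Simplex M), Tendsto u atTop (𝓝 v) → ∀ i,
      Tendsto (fun n => (u n).1 i) atTop (𝓝 (v.1 i)) := fun u v h i =>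
    (((continuous_apply i).comp continuous_subtype_val).tendsto v).comp h
  -- letters outside the support of `p` only decrease the likelihood
  set S : Finset (Fin (M + 1)) := Finset.univ.filter fun i => 0 < p.1 i with hS
  have hkey : Real.exp (-a) * ∏ i, p.1 i ^ p.1 i ≤ ∏ i ∈ S, y.1 i ^ p.1 i := by
    refine le_of_tendsto_of_tendsto' (f := fun n => Real.exp (-a) *
        ∏ i, (μ (φ n)).1 i ^ (μ (φ n)).1 i)
      (g := fun n => ∏ i ∈ S, (x (φ n)).1 i ^ (μ (φ n)).1 i)
      (((continuous_prod_rpow_self.tendsto p).comp hμp).const_mul _)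
      (tendsto_finsetProd _ fun i hi => ?_) fun n => (hlt (φ n)).le.trans ?_
    · have hi' : 0 < p.1 i := (Finset.mem_filter.1 hi).2
      exact (hcoord _ _ hy i).rpow (hcoord _ _ hμp i) (Or.inr hi')
    · rw [← Finset.prod_filter_mul_prod_filter_not Finset.univ (fun i => 0 < p.1 i)]
      refine mul_le_of_le_one_right
        (Finset.prod_nonneg fun i _ => Real.rpow_nonneg ((x (φ n)).2.1 i) _) ?_
      exact Finset.prod_le_one (fun i _ => Real.rpow_nonneg ((x (φ n)).2.1 i) _)
        fun i _ => Real.rpow_le_one ((x (φ n)).2.1 i) ((x (φ n)).le_one i) ((μ (φ n)).2.1 i)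
  have hfull : ∏ i ∈ S, y.1 i ^ p.1 i = ∏ i, y.1 i ^ p.1 i := by
    refine Finset.prod_subset (Finset.subset_univ _) fun i _ hi => ?_
    have : p.1 i = 0 := le_antisymm (by simpa [hS] using hi) (p.2.1 i)
    rw [this, Real.rpow_zero]
  rw [hfull] at hkey
  have hK : Kinf ρ s (discreteLaw s p) r ≤ ENNReal.ofReal a :=
    (iInf₂_le (discreteLaw s y) ⟨⟨y, rfl⟩, hry⟩).trans (klDiv_discreteLaw_le hs hkey)
  exact absurd ha hK.not_gt

/-- Since `K_inf` is attained, it vanishes only at laws whose risk reaches the level. -/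
lemma DominantOn.Kinf_pos {ρ : ProbabilityMeasure C → ℝ} {s : Fin (M + 1) → C}
    {Q : Finset (Fin (M + 1)) → Prop} (h : DominantOn ρ s Q) {μ : ProbabilityMeasure C}
    (hμ : μ ∈ alphabetLaws s) {r : ℝ} (hr : ∃ η ∈ alphabetLaws s, r ≤ ρ η) (hlt : ρ μ < r) :
    0 < Kinf ρ s μ r := by
  obtain ⟨p, hp, hK, -⟩ := h μ hμ r hr
  rw [pos_iff_ne_zero, hK, Ne, InformationTheory.klDiv_eq_zero_iff]
  intro he
  have : μ = discreteLaw s p := Subtype.ext he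
  rw [this] at hlt
  exact hlt.not_ge hp

end Alphabet

/-! ### Ratios of Dirichlet probabilities -/

section DirichletRatio

variable {M : ℕ}

/-- The coordinates `(x_1, …, x_M)` on the simplex. -/
def tailCoord (x : Simplex M) (i : Fin M) : ℝ := x.1 i.succ

lemma continuous_tailCoord : Continuous (tailCoord : Simplex M → Fin M → ℝ) :=
  continuous_pi fun i => (continuous_apply i.succ).comp continuous_subtype_val

lemma measurableEmbedding_tailCoord :
    MeasurableEmbedding (tailCoord : Simplex M → Fin M → ℝ) := by
  refine (continuous_tailCoord.isClosedEmbedding fun x y h => ?_).measurableEmbedding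
  have hs : ∀ i : Fin M, x.1 i.succ = y.1 i.succ := fun i => congrFun h i
  have hx := x.2.2
  have hy := y.2.2
  rw [Fin.sum_univ_succ] at hx hy
  refine Subtype.ext (funext (Fin.cases ?_ hs))
  have : ∑ i : Fin M, x.1 i.succ = ∑ i : Fin M, y.1 i.succ :=
    Finset.sum_congr rfl fun i _ => hs i
  linarith

lemma simplexVolume_apply (B : Set (Simplex M)) :
    simplexVolume M B = volume (tailCoord '' B) :=
  measurableEmbedding_tailCoord.comap_apply volume B

instance : IsFiniteMeasure (simplexVolume M) := ⟨by
  rw [simplexVolume_apply, Set.image_univ]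
  exact (isCompact_range continuous_tailCoord).measure_lt_top⟩

lemma simplexVolume_univ_pos : 0 < simplexVolume M Set.univ := by
  rw [simplexVolume_apply, Set.image_univ]
  set U : Set (Fin M → ℝ) := {y | (∀ i, 0 < y i) ∧ ∑ i, y i < 1} with hU
  have hUo : IsOpen U := by
    have e : U = Set.pi Set.univ (fun _ => Set.Ioi 0) ∩ {y | ∑ i, y i < 1} := by
      ext y
      simp [hU]
    rw [e]
    exact (isOpen_set_pi Set.finite_univ fun i _ => isOpen_Ioi).inter
      (isOpen_lt (continuous_finsetSum _ fun i _ => continuous_apply i) continuous_const)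
  have hUn : U.Nonempty := by
    refine ⟨fun _ => 1 / (M + 1), fun i => by positivity, ?_⟩
    simp only [Finset.sum_const, Finset.card_univ, Fintype.card_fin, nsmul_eq_mul, mul_one_div]
    rw [div_lt_one (by positivity)]
    linarith
  refine (hUo.measure_pos volume hUn).trans_le (measure_mono fun y hy => ?_)
  have h0 : ∀ i : Fin (M + 1), 0 ≤ (Fin.cons (1 - ∑ i, y i) y : Fin (M + 1) → ℝ) i :=
    Fin.cases (by simpa using hy.2.le) fun i => by simpa using (hy.1 i).le
  refine ⟨⟨Fin.cons (1 - ∑ i, y i) y, h0, by simp [Fin.sum_univ_succ]⟩, ?_⟩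
  funext i
  simp [tailCoord]

/-- Contracting the simplex by the factor `θ` towards one of its points multiplies the volume by
`θ ^ M`. -/
lemma simplexVolume_range_mix (θ : unitInterval) (x : Simplex M) :
    simplexVolume M (Set.range (mix θ x)) =
      ENNReal.ofReal ((θ : ℝ) ^ M) * simplexVolume M Set.univ := by
  rw [simplexVolume_apply, simplexVolume_apply, Set.image_univ, ← Set.range_comp]
  have e : tailCoord ∘ mix θ x = AffineMap.homothety (tailCoord x) (θ : ℝ) ∘ tailCoord := by
    funext z
    funext i
    simp [tailCoord, mix, AffineMap.homothety_apply]
    ring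
  rw [e, Set.range_comp, Measure.addHaar_image_homothety, Module.finrank_fin_fun,
    abs_of_nonneg (pow_nonneg θ.2.1 _)]

/-- The normalising constant of the Dirichlet density. -/
noncomputable def dirichletConst (c : Fin (M + 1) → ℕ) : ℝ :=
  Real.Gamma (∑ i, (1 + (c i : ℝ))) / ∏ i, Real.Gamma (1 + (c i : ℝ))

lemma dirichletConst_pos (c : Fin (M + 1) → ℕ) : 0 < dirichletConst c :=
  div_pos (Real.Gamma_pos_of_pos (Finset.sum_pos (fun i _ => by positivity)
    Finset.univ_nonempty)) (Finset.prod_pos fun i _ => Real.Gamma_pos_of_pos (by positivity))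

lemma dirichlet_apply (c : Fin (M + 1) → ℕ) {B : Set (Simplex M)} (hB : MeasurableSet B) :
    dirichlet (fun i => 1 + (c i : ℝ)) B =
      ∫⁻ x in B, ENNReal.ofReal (dirichletConst c * likelihood c x) ∂simplexVolume M := by
  rw [dirichlet, withDensity_apply _ hB]
  refine lintegral_congr fun x => ?_
  simp [dirichletDensity, dirichletConst, likelihood]

lemma dirichlet_le (c : Fin (M + 1) → ℕ) {B : Set (Simplex M)} (hB : MeasurableSet B) {b : ℝ}
    (hb : ∀ x ∈ B, likelihood c x ≤ b) :
    dirichlet (fun i => 1 + (c i : ℝ)) B ≤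
      ENNReal.ofReal (dirichletConst c * b) * simplexVolume M Set.univ := by
  rw [dirichlet_apply c hB]
  refine (setLIntegral_mono' hB fun x hx => ENNReal.ofReal_le_ofReal
    (mul_le_mul_of_nonneg_left (hb x hx) (dirichletConst_pos c).le)).trans ?_
  rw [setLIntegral_const]
  gcongr
  exact Set.subset_univ B

lemma dirichlet_ge (c : Fin (M + 1) → ℕ) {B : Set (Simplex M)} (θ : unitInterval) (x : Simplex M)
    (hB : ∀ z, mix θ x z ∈ B) :
    ENNReal.ofReal (dirichletConst c * ((1 - θ : ℝ) ^ (∑ i, c i) * likelihood c x)) *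
      (ENNReal.ofReal ((θ : ℝ) ^ M) * simplexVolume M Set.univ) ≤
      dirichlet (fun i => 1 + (c i : ℝ)) B := by
  have hcont : Continuous (mix θ x) := by
    refine Continuous.subtype_mk (continuous_pi fun i => ?_) _
    exact continuous_const.add
      (continuous_const.mul ((continuous_apply i).comp continuous_subtype_val))
  have hm : MeasurableSet (Set.range (mix θ x)) := (isCompact_range hcont).measurableSet
  calc _ ≤ dirichlet (fun i => 1 + (c i : ℝ)) (Set.range (mix θ x)) := by
        rw [dirichlet_apply c hm, ← simplexVolume_range_mix θ x, ← setLIntegral_const]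
        refine setLIntegral_mono' hm fun y hy => ?_
        obtain ⟨z, rfl⟩ := hy
        exact ENNReal.ofReal_le_ofReal
          (mul_le_mul_of_nonneg_left (likelihood_mix_ge c θ x z) (dirichletConst_pos c).le)
    _ ≤ _ := measure_mono (Set.range_subset_iff.2 hB)

lemma dirichlet_ne_top (c : Fin (M + 1) → ℕ) (B : Set (Simplex M)) :
    dirichlet (fun i => 1 + (c i : ℝ)) B ≠ ∞ := by
  refine ((measure_mono (Set.subset_univ B)).trans_lt
    ((dirichlet_le c MeasurableSet.univ fun x _ => likelihood_le_empirical c x).trans_lt ?_)).ne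
  exact ENNReal.mul_lt_top ENNReal.ofReal_lt_top (measure_lt_top _ _)

/-- The probability of `B` under a Dirichlet posterior is at most its largest likelihood; that of
`B'` is at least the likelihood on a small copy of the simplex inside `B'`. Comparing the two, the
normalising constant and the volume of the simplex cancel. -/
lemma dirichlet_real_mul_le (c : Fin (M + 1) → ℕ) {B B' : Set (Simplex M)} (hB : MeasurableSet B)
    {b : ℝ} (hb0 : 0 ≤ b) (hb : ∀ x ∈ B, likelihood c x ≤ b) (θ : unitInterval) (x : Simplex M)
    (hB' : ∀ z, mix θ x z ∈ B') :
    (dirichlet (fun i => 1 + (c i : ℝ))).real B *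
        ((θ : ℝ) ^ M * (1 - θ) ^ (∑ i, c i) * likelihood c x) ≤
      b * (dirichlet (fun i => 1 + (c i : ℝ))).real B' := by
  have h1 := ENNReal.toReal_mono (by finiteness) (dirichlet_le c hB hb)
  have h2 := ENNReal.toReal_mono (dirichlet_ne_top c B') (dirichlet_ge c θ x hB')
  have hk := (dirichletConst_pos c).le
  have hl := likelihood_nonneg c x
  have hθ : 0 ≤ (1 - θ : ℝ) := sub_nonneg.2 θ.2.2
  have hθ0 : 0 ≤ (θ : ℝ) := θ.2.1
  rw [ENNReal.toReal_mul, ENNReal.toReal_ofReal (by positivity)] at h1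
  rw [ENNReal.toReal_mul, ENNReal.toReal_mul, ENNReal.toReal_ofReal (by positivity),
    ENNReal.toReal_ofReal (by positivity)] at h2
  calc _ ≤ (dirichletConst c * b * (simplexVolume M Set.univ).toReal) *
        ((θ : ℝ) ^ M * (1 - θ) ^ (∑ i, c i) * likelihood c x) :=
        mul_le_mul_of_nonneg_right h1 (by positivity)
    _ = b * (dirichletConst c * ((1 - θ) ^ (∑ i, c i) * likelihood c x) *
        ((θ : ℝ) ^ M * (simplexVolume M Set.univ).toReal)) := by ring
    _ ≤ _ := mul_le_mul_of_nonneg_left h2 hb0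

lemma dirichlet_real_pos (c : Fin (M + 1) → ℕ) {B : Set (Simplex M)} (θ : unitInterval)
    (hθ0 : 0 < (θ : ℝ)) (hθ1 : (θ : ℝ) < 1) (x : Simplex M) (hx : 0 < likelihood c x)
    (hB : ∀ z, mix θ x z ∈ B) : 0 < (dirichlet (fun i => 1 + (c i : ℝ))).real B := by
  refine ENNReal.toReal_pos (LT.lt.ne' ?_) (dirichlet_ne_top c B)
  refine lt_of_lt_of_le ?_ (dirichlet_ge c θ x hB)
  have := dirichletConst_pos c
  have : 0 < 1 - (θ : ℝ) := sub_pos.2 hθ1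
  exact ENNReal.mul_pos (ENNReal.ofReal_pos.2 (by positivity)).ne'
    (ENNReal.mul_pos (ENNReal.ofReal_pos.2 (by positivity)).ne' simplexVolume_univ_pos.ne').ne'

/-- A ratio of two probabilities under the Dirichlet posterior with letter counts `c`. -/
noncomputable def posteriorRatio (c : Fin (M + 1) → ℕ) (B B' : Set (Simplex M)) : ℝ :=
  (dirichlet (fun i => 1 + (c i : ℝ))).real B / (dirichlet (fun i => 1 + (c i : ℝ))).real B'

lemma posteriorRatio_nonneg (c : Fin (M + 1) → ℕ) (B B' : Set (Simplex M)) :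
    0 ≤ posteriorRatio c B B' := div_nonneg measureReal_nonneg measureReal_nonneg

lemma posteriorRatio_mul_le (c : Fin (M + 1) → ℕ) {B B' : Set (Simplex M)} (hB : MeasurableSet B)
    {b : ℝ} (hb0 : 0 ≤ b) (hb : ∀ x ∈ B, likelihood c x ≤ b) (θ : unitInterval) (x : Simplex M)
    (hB' : ∀ z, mix θ x z ∈ B') :
    posteriorRatio c B B' * ((θ : ℝ) ^ M * (1 - θ) ^ (∑ i, c i) * likelihood c x) ≤ b := by
  rw [posteriorRatio, div_mul_eq_mul_div]
  exact div_le_of_le_mul₀ measureReal_nonneg hb0 (dirichlet_real_mul_le c hB hb0 hb θ x hB')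

end DirichletRatio

/-! ### Letter counts along a run -/

section Run

lemma measureReal_inter_eq_setIntegral {Ω : Type*} {m mΩ : MeasurableSpace Ω} (hm : m ≤ mΩ)
    {P : Measure Ω} [IsProbabilityMeasure P] {H E : Set Ω} (hH : MeasurableSet[m] H)
    (hE : MeasurableSet E) {f : Ω → ℝ} (hf : P⟦E | m⟧ =ᵐ[P] f) :
    P.real (H ∩ E) = ∫ ω in H, f ω ∂P := by
  rw [← integral_congr_ae (ae_restrict_of_ae hf),
    setIntegral_condExp hm ((integrable_const 1).indicator hE) hH, setIntegral_indicator hE]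
  simp

lemma likelihood_eq_mul_sub_single {M : ℕ} {c : Fin (M + 1) → ℕ} {i : Fin (M + 1)} (hi : c i ≠ 0)
    (x : Simplex M) : likelihood c x = x.1 i * likelihood (c - Pi.single i 1) x := by
  have h : likelihood (c - Pi.single i 1) x =
      x.1 i ^ (c i - 1) * ∏ j ∈ Finset.univ.erase i, x.1 j ^ c j := by
    rw [likelihood, ← Finset.mul_prod_erase _ _ (Finset.mem_univ i)]
    congr 1
    · simp
    · refine Finset.prod_congr rfl fun j hj => ?_
      simp [Pi.single_eq_of_ne (Finset.ne_of_mem_erase hj)]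
  rw [h, likelihood, ← Finset.mul_prod_erase _ _ (Finset.mem_univ i), ← mul_assoc, ← pow_succ',
    Nat.sub_add_cancel (Nat.one_le_iff_ne_zero.2 hi)]

variable {C : Set ℝ} {M K : ℕ} {Ω : Type*} {s : Fin (M + 1) → C} {A : ℕ → Ω → Fin K}
  {X : ℕ → Ω → C}

open Classical in
lemma rewardCount_eq_sum (t : ℕ) (ω : Ω) (k : Fin K) (i : Fin (M + 1)) :
    rewardCount s A X t ω k i = ∑ u ∈ Finset.range t, if A u ω = k ∧ X u ω = s i then 1 else 0 := by
  rw [rewardCount, ← Finset.card_filter, ← Set.ncard_coe_finset]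
  congr 1
  ext u
  simp

lemma rewardCount_zero (ω : Ω) (k : Fin K) : rewardCount s A X 0 ω k = 0 := by
  classical
  funext i
  simp [rewardCount_eq_sum]

lemma rewardCount_succ_of_ne {t : ℕ} {ω : Ω} {k : Fin K} (h : A t ω ≠ k) :
    rewardCount s A X (t + 1) ω k = rewardCount s A X t ω k := by
  classical
  funext i
  rw [rewardCount_eq_sum, rewardCount_eq_sum, Finset.sum_range_succ, if_neg fun h' => h h'.1,
    add_zero]

lemma rewardCount_succ_of_eq (hs : Function.Injective s) {t : ℕ} {ω : Ω} {k : Fin K}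
    (h : A t ω = k) {i : Fin (M + 1)} (hi : X t ω = s i) :
    rewardCount s A X (t + 1) ω k = rewardCount s A X t ω k + Pi.single i 1 := by
  classical
  funext j
  rw [Pi.add_apply, rewardCount_eq_sum, rewardCount_eq_sum, Finset.sum_range_succ]
  congr 1
  simp [h, hi, hs.eq_iff, Pi.single_apply, eq_comm]

lemma rewardCount_le (t : ℕ) (ω : Ω) (k : Fin K) (i : Fin (M + 1)) :
    rewardCount s A X t ω k i ≤ t := by
  classical
  rw [rewardCount_eq_sum, ← Finset.card_filter]
  simpa using Finset.card_filter_le (Finset.range t) _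

variable [mΩ : MeasurableSpace Ω] {ρ : ProbabilityMeasure C → ℝ} {ν : Fin K → ProbabilityMeasure C}
  {P : Measure Ω} {𝓕 : Filtration ℕ mΩ} {L : ℕ → Ω → Fin K → Simplex M}

namespace IsRhoMTS

variable (hrun : IsRhoMTS ρ s ν P 𝓕 L A X)
include hrun

lemma measurableSet_arm_eq (t : ℕ) (k : Fin K) : MeasurableSet {ω | A t ω = k} :=
  𝓕.le (t + 1) _ (hrun.measurable_arm t (measurableSet_singleton k))

lemma measurableSet_sample (t : ℕ) {B : Fin K → Set (Simplex M)} (hB : ∀ k, MeasurableSet (B k)) :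
    MeasurableSet {ω | ∀ k, L t ω k ∈ B k} := by
  refine 𝓕.le (t + 1) _ ?_
  have : {ω | ∀ k, L t ω k ∈ B k} = L t ⁻¹' Set.pi Set.univ B := by
    ext ω
    simp
  rw [this]
  exact hrun.measurable_sample t (MeasurableSet.univ_pi hB)

lemma measurableSet_count_eq (t : ℕ) (k : Fin K) (c : Fin (M + 1) → ℕ) :
    MeasurableSet[𝓕 t] {ω | rewardCount s A X t ω k = c} := by
  classical
  have h : ∀ i, Measurable[𝓕 t] fun ω => rewardCount s A X t ω k i := fun i => by
    simp_rw [rewardCount_eq_sum]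
    refine Finset.measurable_sum _ fun u hu => ?_
    have hle : 𝓕 (u + 1) ≤ 𝓕 t := 𝓕.mono (Finset.mem_range.1 hu)
    refine Measurable.ite ?_ measurable_const measurable_const
    exact (hle _ (hrun.measurable_arm u (measurableSet_singleton k))).inter
      (hle _ (hrun.measurable_reward u (measurableSet_singleton (s i))))
  have e : {ω | rewardCount s A X t ω k = c} = ⋂ i, {ω | rewardCount s A X t ω k i = c i} := by
    ext ω
    simp [funext_iff]
  rw [e]
  exact MeasurableSet.iInter fun i => h i (measurableSet_singleton _)

variable [IsProbabilityMeasure P]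

lemma measureReal_reward {t : ℕ} {H : Set Ω} (hH : MeasurableSet[𝓕 t] H) (k : Fin K) {B : Set C}
    (hB : MeasurableSet B) :
    P.real ((H ∩ {ω | A t ω = k}) ∩ X t ⁻¹' B) =
      (ν k : Measure C).real B * P.real (H ∩ {ω | A t ω = k}) := by
  have hL : Measurable (L t) := (hrun.measurable_sample t).mono (𝓕.le _) le_rfl
  have hA : Measurable (A t) := (hrun.measurable_arm t).mono (𝓕.le _) le_rfl
  have hX : Measurable (X t) := (hrun.measurable_reward t).mono (𝓕.le _) le_rfl
  have hH' : MeasurableSet[𝓕 t ⊔ MeasurableSpace.comap (L t) inferInstance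
      ⊔ MeasurableSpace.comap (A t) inferInstance] (H ∩ {ω | A t ω = k}) :=
    ((le_sup_left.trans le_sup_left : 𝓕 t ≤ _) _ hH).inter
      (le_sup_right (a := 𝓕 t ⊔ MeasurableSpace.comap (L t) inferInstance) _
        ⟨{k}, measurableSet_singleton k, rfl⟩)
  rw [measureReal_inter_eq_setIntegral
    (sup_le (sup_le (𝓕.le t) hL.comap_le) hA.comap_le) hH' (hX hB) (hrun.reward_law t B hB)]
  have e : ∀ ω ∈ H ∩ {ω | A t ω = k}, (ν (A t ω) : Measure C).real B = (ν k : Measure C).real B :=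
    fun ω hω => by rw [show A t ω = k from hω.2]
  rw [setIntegral_congr_fun ((𝓕.le t _ hH).inter (hrun.measurableSet_arm_eq t k)) e,
    setIntegral_const, smul_eq_mul, mul_comm]

lemma ae_reward_mem (hν : ∀ k, ν k ∈ alphabetLaws s) (t : ℕ) :
    ∀ᵐ ω ∂P, X t ω ∈ Set.range s := by
  classical
  have hB : MeasurableSet (Set.range s)ᶜ := (Set.finite_range s).measurableSet.compl
  have h : ∀ k, ∀ᵐ ω ∂P, A t ω = k → X t ω ∈ Set.range s := fun k => by
    obtain ⟨p, hp⟩ := hν k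
    have h1 := hrun.measureReal_reward (t := t) (H := Set.univ) MeasurableSet.univ k hB
    rw [← hp, discreteLaw_real] at h1
    simp only [Set.mem_compl_iff, Set.mem_range_self, not_true_eq_false, if_false,
      Finset.sum_const_zero, zero_mul] at h1
    rw [measureReal_eq_zero_iff] at h1
    filter_upwards [measure_eq_zero_iff_ae_notMem.1 h1] with ω hω hA
    by_contra hX
    exact hω ⟨⟨trivial, hA⟩, hX⟩
  filter_upwards [ae_all_iff.2 h] with ω hω using hω _ rfl

/-- Probability flow through the count vector `c` of arm `k` in one round: it is left when the arm
is played, and entered from the vectors with one occurrence less. -/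
lemma measureReal_count_succ_le (hs : Function.Injective s) {p : Fin K → Simplex M}
    (hp : ∀ k, discreteLaw s (p k) = ν k) (t : ℕ) (k : Fin K) (c : Fin (M + 1) → ℕ) :
    P.real {ω | rewardCount s A X (t + 1) ω k = c} +
        P.real ({ω | rewardCount s A X t ω k = c} ∩ {ω | A t ω = k}) ≤
      P.real {ω | rewardCount s A X t ω k = c} +
        ∑ i with c i ≠ 0, (p k).1 i *
          P.real ({ω | rewardCount s A X t ω k = c - Pi.single i 1} ∩ {ω | A t ω = k}) := by
  set H := fun c => {ω | rewardCount s A X t ω k = c} with hH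
  set a := {ω | A t ω = k} with ha
  have hHm : ∀ c, MeasurableSet (H c) := fun c => 𝓕.le t _ (hrun.measurableSet_count_eq t k c)
  have ham : MeasurableSet a := hrun.measurableSet_arm_eq t k
  have hν : ∀ k, ν k ∈ alphabetLaws s := fun k => ⟨p k, hp k⟩
  have hsub : {ω | rewardCount s A X (t + 1) ω k = c} ≤ᵐ[P]
      ((H c \ a) ∪ ⋃ i ∈ Finset.univ.filter fun i => c i ≠ 0,
        (H (c - Pi.single i 1) ∩ a) ∩ X t ⁻¹' {s i} : Set Ω) := by
    filter_upwards [hrun.ae_reward_mem hν t] with ω hX hω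
    obtain ⟨i, hi⟩ := hX
    change rewardCount s A X (t + 1) ω k = c at hω
    by_cases hA : A t ω = k
    · refine Or.inr ?_
      rw [rewardCount_succ_of_eq hs hA hi.symm] at hω
      refine Set.mem_biUnion (x := i) ?_ ⟨⟨?_, hA⟩, hi.symm⟩
      · simp [← hω]
      · exact eq_tsub_of_add_eq hω
    · rw [rewardCount_succ_of_ne hA] at hω
      exact Or.inl ⟨hω, hA⟩
  have h1 : P.real {ω | rewardCount s A X (t + 1) ω k = c} ≤ P.real (H c \ a) +
      ∑ i with c i ≠ 0, P.real ((H (c - Pi.single i 1) ∩ a) ∩ X t ⁻¹' {s i}) := by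
    refine (ENNReal.toReal_mono (measure_ne_top _ _) (measure_mono_ae hsub)).trans ?_
    refine (measureReal_union_le _ _).trans ?_
    gcongr
    exact measureReal_biUnion_finset_le _ _
  have h2 : P.real (H c \ a) + P.real (H c ∩ a) = P.real (H c) := by
    rw [add_comm]
    exact measureReal_inter_add_sdiff ham
  have h3 : ∀ i, P.real ((H (c - Pi.single i 1) ∩ a) ∩ X t ⁻¹' {s i}) =
      (p k).1 i * P.real (H (c - Pi.single i 1) ∩ a) := fun i => by
    rw [hrun.measureReal_reward (hrun.measurableSet_count_eq t k _) k (measurableSet_singleton _),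
      ← hp k, discreteLaw_real_singleton hs]
  rw [Finset.sum_congr rfl fun i _ => h3 i] at h1
  linarith

/-- The expected number of plays of arm `k` at letter counts `c` is at most the likelihood ratio of
the law of the arm to any other law. -/
lemma sum_visits_mul_likelihood_le (hs : Function.Injective s) {p : Fin K → Simplex M}
    (hp : ∀ k, discreteLaw s (p k) = ν k) (N : ℕ) (k : Fin K) (x : Simplex M)
    (c : Fin (M + 1) → ℕ) :
    (∑ t ∈ Finset.range N, P.real ({ω | rewardCount s A X t ω k = c} ∩ {ω | A t ω = k})) *
      likelihood c x ≤ likelihood c (p k) := by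
  have flow : ∀ c : Fin (M + 1) → ℕ,
      ∑ t ∈ Finset.range N, P.real ({ω | rewardCount s A X t ω k = c} ∩ {ω | A t ω = k}) ≤
        P.real {ω | rewardCount s A X 0 ω k = c} + ∑ i with c i ≠ 0, (p k).1 i *
          ∑ t ∈ Finset.range N, P.real
            ({ω | rewardCount s A X t ω k = c - Pi.single i 1} ∩ {ω | A t ω = k}) := fun c => by
    have h := Finset.sum_le_sum fun t (_ : t ∈ Finset.range N) =>
      hrun.measureReal_count_succ_le hs hp t k c
    have htel := Finset.sum_range_sub (fun t => P.real {ω | rewardCount s A X t ω k = c}) N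
    simp only [Finset.sum_add_distrib, Finset.sum_sub_distrib] at h htel
    rw [Finset.sum_comm] at h
    simp only [← Finset.mul_sum] at h
    have : 0 ≤ P.real {ω | rewardCount s A X N ω k = c} := measureReal_nonneg
    linarith
  induction hn : ∑ i, c i generalizing c with
  | zero =>
    have hc : c = 0 := funext fun i => Finset.sum_eq_zero_iff.1 hn i (Finset.mem_univ i)
    have h1 := flow c
    have h2 : P.real {ω | rewardCount s A X 0 ω k = c} ≤ 1 := measureReal_le_one
    subst hc
    simp only [Pi.zero_apply, ne_eq, not_true_eq_false, Finset.filter_false, Finset.sum_empty,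
      add_zero] at h1
    simp only [likelihood, Pi.zero_apply, pow_zero, Finset.prod_const_one, mul_one]
    exact h1.trans h2
  | succ n ih =>
    have hc : c ≠ 0 := by
      rintro rfl
      simp at hn
    have h0 : P.real {ω | rewardCount s A X 0 ω k = c} = 0 := by
      simp [rewardCount_zero, hc.symm]
    have h1 := mul_le_mul_of_nonneg_right (flow c) (likelihood_nonneg c x)
    refine h1.trans ?_
    rw [h0, zero_add, Finset.sum_mul]
    have h2 : ∀ i ∈ Finset.univ.filter fun i => c i ≠ 0, (p k).1 i *
        (∑ t ∈ Finset.range N, P.real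
          ({ω | rewardCount s A X t ω k = c - Pi.single i 1} ∩ {ω | A t ω = k})) *
        likelihood c x ≤ x.1 i * likelihood c (p k) := fun i hi => by
      have hci : c i ≠ 0 := (Finset.mem_filter.1 hi).2
      have hsum : ∑ j, (c - Pi.single i 1 : Fin (M + 1) → ℕ) j = n := by
        have hle : Pi.single i 1 ≤ c := by
          intro j
          by_cases hj : j = i
          · subst hj
            simpa using Nat.one_le_iff_ne_zero.2 hci
          · simp [Pi.single_eq_of_ne hj]
        simp only [Pi.sub_apply]
        rw [Finset.sum_tsub_distrib _ fun j _ => hle j, hn]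
        simp
      have h3 := mul_le_mul_of_nonneg_left (ih _ hsum)
        (mul_nonneg (x.2.1 i) ((p k).2.1 i))
      rw [likelihood_eq_mul_sub_single hci x, likelihood_eq_mul_sub_single hci (p k)]
      linarith
    refine (Finset.sum_le_sum h2).trans ?_
    rw [← Finset.sum_mul]
    refine mul_le_of_le_one_left (likelihood_nonneg _ _) ?_
    rw [← x.2.2]
    exact Finset.sum_le_sum_of_subset_of_nonneg (Finset.filter_subset _ _) fun i _ _ => x.2.1 i

lemma sum_visits_le_one (hs : Function.Injective s) {p : Fin K → Simplex M}
    (hp : ∀ k, discreteLaw s (p k) = ν k) (N : ℕ) (k : Fin K) (c : Fin (M + 1) → ℕ) :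
    ∑ t ∈ Finset.range N, P.real ({ω | rewardCount s A X t ω k = c} ∩ {ω | A t ω = k}) ≤ 1 := by
  have h := (hrun.sum_visits_mul_likelihood_le hs hp N k (empirical c) c).trans
    (likelihood_le_empirical c (p k))
  exact (mul_le_iff_le_one_left (likelihood_empirical_pos c)).1 h

/-- Arm `k` is played at most `m` times before it has `m` observations. -/
lemma sum_measureReal_count_lt_le (hs : Function.Injective s) (hν : ∀ k, ν k ∈ alphabetLaws s)
    (N m : ℕ) (k : Fin K) :
    ∑ t ∈ Finset.range N,
      P.real {ω | A t ω = k ∧ ∑ i, rewardCount s A X t ω k i < m} ≤ m := by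
  classical
  have hm : ∀ t, MeasurableSet {ω | A t ω = k ∧ ∑ i, rewardCount s A X t ω k i < m} := fun t => by
    have e : {ω | A t ω = k ∧ ∑ i, rewardCount s A X t ω k i < m} = {ω | A t ω = k} ∩
        ⋃ c ∈ {c : Fin (M + 1) → ℕ | ∑ i, c i < m}, {ω | rewardCount s A X t ω k = c} := by
      ext ω
      simp
    rw [e]
    exact (hrun.measurableSet_arm_eq t k).inter (MeasurableSet.biUnion (Set.to_countable _)
      fun c _ => 𝓕.le t _ (hrun.measurableSet_count_eq t k c))
  have hpt : ∀ᵐ ω ∂P, ∑ t ∈ Finset.range N,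
      {ω | A t ω = k ∧ ∑ i, rewardCount s A X t ω k i < m}.indicator (fun _ => (1 : ℝ)) ω ≤ m := by
    filter_upwards [ae_all_iff.2 (hrun.ae_reward_mem hν)] with ω hω
    suffices H : ∑ t ∈ Finset.range N,
        {ω | A t ω = k ∧ ∑ i, rewardCount s A X t ω k i < m}.indicator (fun _ => (1 : ℝ)) ω ≤
          (min (∑ i, rewardCount s A X N ω k i) m : ℕ) from
      H.trans (by exact_mod_cast min_le_right _ _)
    induction N with
    | zero => simp [rewardCount_zero]
    | succ N ih =>
      rw [Finset.sum_range_succ]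
      obtain ⟨i, hi⟩ := hω N
      by_cases hA : A N ω = k
      · rw [rewardCount_succ_of_eq hs hA hi.symm]
        have e : ∑ j, (rewardCount s A X N ω k + Pi.single i 1 : Fin (M + 1) → ℕ) j =
            ∑ j, rewardCount s A X N ω k j + 1 := by
          simp [Finset.sum_add_distrib]
        rw [e]
        by_cases hlt : ∑ i, rewardCount s A X N ω k i < m
        · rw [Set.indicator_of_mem (by exact ⟨hA, hlt⟩)]
          have : min (∑ j, rewardCount s A X N ω k j + 1) m =
              min (∑ j, rewardCount s A X N ω k j) m + 1 := by omega
          rw [this]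
          push_cast at ih ⊢
          linarith
        · rw [Set.indicator_of_notMem (fun h => hlt h.2), add_zero]
          refine ih.trans ?_
          exact_mod_cast min_le_min_right m (Nat.le_succ _)
      · rw [Set.indicator_of_notMem (fun h => hA h.1), add_zero, rewardCount_succ_of_ne hA]
        exact ih
  have hint : ∀ t ∈ Finset.range N, Integrable
      ({ω | A t ω = k ∧ ∑ i, rewardCount s A X t ω k i < m}.indicator fun _ => (1 : ℝ)) P :=
    fun t _ => (integrable_const 1).indicator (hm t)
  calc _ = ∫ ω, ∑ t ∈ Finset.range N,
        {ω | A t ω = k ∧ ∑ i, rewardCount s A X t ω k i < m}.indicator (fun _ => (1 : ℝ)) ω ∂P := by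
        rw [integral_finsetSum _ hint]
        refine Finset.sum_congr rfl fun t _ => ?_
        rw [integral_indicator (hm t)]
        simp
    _ ≤ ∫ _, (m : ℝ) ∂P := integral_mono_ae (integrable_finsetSum _ hint) (integrable_const _) hpt
    _ = m := by simp

/-- Conditionally on the past, changing the target set of the sample of one arm changes the
probability by a ratio that depends only on the letter counts of that arm. -/
lemma measureReal_sample_update (t : ℕ) (j : Fin K) (c : Fin (M + 1) → ℕ)
    {B B' G : Set (Simplex M)} (hB : MeasurableSet B) (hB' : MeasurableSet B')
    (hG : MeasurableSet G) (hpos : 0 < (dirichlet (fun i => 1 + (c i : ℝ))).real B') :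
    P.real ({ω | rewardCount s A X t ω j = c} ∩
        {ω | ∀ k, L t ω k ∈ Function.update (fun _ => G) j B k}) =
      posteriorRatio c B B' * P.real ({ω | rewardCount s A X t ω j = c} ∩
        {ω | ∀ k, L t ω k ∈ Function.update (fun _ => G) j B' k}) := by
  have hupd : ∀ {D : Set (Simplex M)}, MeasurableSet D → ∀ k, MeasurableSet
      (Function.update (fun _ => G) j D k) := fun hD k => by
    by_cases hk : k = j
    · subst hk
      simpa using hD
    · simpa [Function.update_of_ne hk] using hG
  have hH := hrun.measurableSet_count_eq t j c
  have key : ∀ {D : Set (Simplex M)}, MeasurableSet D →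
      P.real ({ω | rewardCount s A X t ω j = c} ∩
        {ω | ∀ k, L t ω k ∈ Function.update (fun _ => G) j D k}) =
      (dirichlet (fun i => 1 + (c i : ℝ))).real D *
        ∫ ω in {ω | rewardCount s A X t ω j = c},
          ∏ k ∈ Finset.univ.erase j, (dirichlet (posteriorParam s A X t ω k)).real G ∂P :=
    fun {D} hD => by
    rw [measureReal_inter_eq_setIntegral (𝓕.le t) hH
      (hrun.measurableSet_sample t (hupd hD)) (hrun.sample_law t _ (hupd hD)),
      ← integral_const_mul]
    refine setIntegral_congr_fun (𝓕.le t _ hH) fun ω hω => ?_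
    change rewardCount s A X t ω j = c at hω
    have e : posteriorParam s A X t ω j = fun i => 1 + (c i : ℝ) := by
      funext i
      rw [posteriorParam, hω]
    rw [← Finset.mul_prod_erase _ _ (Finset.mem_univ j), Function.update_self, e]
    congr 1
    refine Finset.prod_congr rfl fun k hk => ?_
    rw [Function.update_of_ne (Finset.ne_of_mem_erase hk)]
  rw [key hB, key hB', posteriorRatio]
  field_simp

end IsRhoMTS

end Run

/-! ### Exponential bounds on posterior probabilities -/

section PosteriorBounds

variable {M : ℕ}

lemma exists_unitInterval_exp_le {κ δ : ℝ} (hκ : 0 < κ) (hδ : 0 < δ) :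
    ∃ θ : unitInterval, 0 < (θ : ℝ) ∧ (θ : ℝ) < 1 ∧ (θ : ℝ) < δ ∧ Real.exp (-κ) ≤ 1 - θ := by
  have h1 : Real.exp (-κ) < 1 := by rw [Real.exp_lt_one_iff]; linarith
  have h2 := Real.exp_pos (-κ)
  have h3 : 0 < min (δ / 2) (1 - Real.exp (-κ)) := lt_min (half_pos hδ) (by linarith)
  have h4 := min_le_left (δ / 2) (1 - Real.exp (-κ))
  have h5 := min_le_right (δ / 2) (1 - Real.exp (-κ))
  exact ⟨⟨min (δ / 2) (1 - Real.exp (-κ)), h3.le, by linarith⟩, h3, by simp only; linarith,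
    by simp only; linarith, by simp only; linarith⟩

lemma le_mul_exp_of_mul_le {θ w κ κ' : ℝ} {n : ℕ} (hθ0 : 0 < θ)
    (hθ : Real.exp (-κ) ≤ 1 - θ) {d : ℕ} (hw : 0 ≤ w)
    (h : w * (θ ^ d * (1 - θ) ^ n) ≤ Real.exp (-(n * (κ + κ')))) :
    w ≤ (θ ^ d)⁻¹ * Real.exp (-(n * κ')) := by
  have h1 : Real.exp (-(n * κ)) ≤ (1 - θ) ^ n := by
    rw [← mul_neg, Real.exp_nat_mul]
    exact pow_le_pow_left₀ (Real.exp_pos _).le hθ n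
  have h2 : w * (θ ^ d * Real.exp (-(n * κ))) ≤ Real.exp (-(n * (κ + κ'))) :=
    (mul_le_mul_of_nonneg_left (mul_le_mul_of_nonneg_left h1 (by positivity)) hw).trans h
  rw [mul_add, neg_add, Real.exp_add] at h2
  have h3 := Real.exp_pos (-(n * κ))
  have h4 : 0 < θ ^ d := by positivity
  rw [inv_mul_eq_div, le_div_iff₀ h4]
  refine le_of_mul_le_mul_right ?_ h3
  linarith

/-- Let `v` be the probability of the letter counts `c` for an arm with law `q` and risk above `y`.
The odds of a posterior sample with risk at most `y`, weighted by `v`, decay exponentially in the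
sample size. When the empirical law is close to `q`, these odds are small; otherwise the point
`(1 - l) q + l μ` close to `q`, with `μ` the empirical law, still has risk above `y`, and its
likelihood exceeds that of `q` by an exponential factor. -/
lemma exists_posteriorRatio_mul_le_exp {R : Simplex M → ℝ} (hR : Continuous R) {q : Simplex M}
    {y : ℝ} (hy : y < R q) :
    ∃ κ > 0, ∃ D : ℝ, ∀ c : Fin (M + 1) → ℕ,
      0 < (dirichlet (fun i => 1 + (c i : ℝ))).real {x | y < R x} ∧
      ∀ v, 0 ≤ v → v ≤ 1 → (∀ x, v * likelihood c x ≤ likelihood c q) →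
        posteriorRatio c {x | R x ≤ y} {x | y < R x} * v ≤
          D * Real.exp (-((∑ i, c i : ℕ) * κ)) := by
  obtain ⟨δ, hδ, hRδ⟩ : ∃ δ > 0, ∀ u, dist u q < δ → ∀ u', dist u' u < δ → y < R u' := by
    obtain ⟨δ, hδ, h⟩ := Metric.uniformContinuous_iff.1
      (CompactSpace.uniformContinuous_of_continuous hR) ((R q - y) / 2) (by linarith)
    refine ⟨δ, hδ, fun u hu u' hu' => ?_⟩
    have h1 := h hu
    have h2 := h hu'
    rw [Real.dist_eq, abs_lt] at h1 h2
    linarith [h1.1, h2.1]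
  obtain ⟨l, hl0, hl1, hlδ, -⟩ := exists_unitInterval_exp_le one_pos hδ
  have hl2 : 0 < (l : ℝ) * (1 - l) := mul_pos hl0 (sub_pos.2 hl1)
  set κ := min (l * (1 - l) * δ ^ 2) (δ ^ 2 / 4) / 2 with hκ
  have hκ0 : 0 < κ := half_pos (lt_min (by positivity) (by positivity))
  have hκ1 : κ + κ ≤ l * (1 - l) * δ ^ 2 := by
    rw [hκ, add_halves]; exact min_le_left _ _
  have hκ2 : κ + κ ≤ δ ^ 2 / 4 := by
    rw [hκ, add_halves]; exact min_le_right _ _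
  obtain ⟨θ, hθ0, hθ1, hθδ, hθ⟩ := exists_unitInterval_exp_le hκ0 hδ
  refine ⟨κ, hκ0, ((θ : ℝ) ^ M)⁻¹, fun c => ?_⟩
  set μ := empirical c with hμ
  set x := mix l q μ with hx
  have hxL : 0 < likelihood c x := likelihood_pos fun i hi =>
    add_pos_of_nonneg_of_pos (mul_nonneg (sub_nonneg.2 hl1.le) (q.2.1 i))
      (mul_pos hl0 (empirical_pos hi))
  have hθball : ∀ u, dist u q < δ → ∀ z, mix θ u z ∈ {x | y < R x} := fun u hu z =>
    hRδ u hu _ ((dist_mix_le θ u z).trans_lt hθδ)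
  have hxq : dist x q < δ := (dist_mix_le l q μ).trans_lt hlδ
  refine ⟨dirichlet_real_pos c θ hθ0 hθ1 x hxL (hθball x hxq), fun v hv0 hv1 hv => ?_⟩
  set r := posteriorRatio c {x | R x ≤ y} {x | y < R x} with hr
  have hr0 : 0 ≤ r := posteriorRatio_nonneg _ _ _
  have hB : MeasurableSet {x | R x ≤ y} := (isClosed_le hR continuous_const).measurableSet
  have hθ' : 0 < 1 - (θ : ℝ) := sub_pos.2 hθ1
  refine le_mul_exp_of_mul_le (κ := κ) hθ0 hθ (mul_nonneg hr0 hv0) ?_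
  rcases lt_or_ge (dist μ q) δ with hnear | hfar
  · have hμL : 0 < likelihood c μ := likelihood_empirical_pos c
    have h1 : r * ((θ : ℝ) ^ M * (1 - θ) ^ (∑ i, c i) * likelihood c μ) ≤
        Real.exp (-((∑ i, c i : ℕ) * (δ ^ 2 / 4))) * likelihood c μ := by
      refine posteriorRatio_mul_le c hB (by positivity) (fun x' hx' => ?_) θ μ (hθball μ hnear)
      refine likelihood_le_exp_mul_empirical c x' hδ.le (le_of_not_gt fun h => ?_)
      rw [dist_comm] at h
      exact (hRδ μ hnear x' h).not_ge hx'
    have h2 : r * ((θ : ℝ) ^ M * (1 - θ) ^ (∑ i, c i)) ≤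
        Real.exp (-((∑ i, c i : ℕ) * (δ ^ 2 / 4))) := by
      refine le_of_mul_le_mul_right ?_ hμL
      linarith
    calc r * v * ((θ : ℝ) ^ M * (1 - θ) ^ (∑ i, c i))
        = v * (r * ((θ : ℝ) ^ M * (1 - θ) ^ (∑ i, c i))) := by ring
      _ ≤ r * ((θ : ℝ) ^ M * (1 - θ) ^ (∑ i, c i)) := mul_le_of_le_one_left (by positivity) hv1
      _ ≤ _ := h2
      _ ≤ _ := Real.exp_le_exp.2 (neg_le_neg (mul_le_mul_of_nonneg_left hκ2 (Nat.cast_nonneg _)))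
  · have h1 : r * ((θ : ℝ) ^ M * (1 - θ) ^ (∑ i, c i) * likelihood c x) ≤ likelihood c μ :=
      posteriorRatio_mul_le c hB (likelihood_nonneg _ _)
        (fun x' _ => likelihood_le_empirical c x') θ x (hθball x hxq)
    have h2 := likelihood_le_exp_mul_mix c l hl0 q
    have h3 : Real.exp (-((∑ i, c i : ℕ) * (l * (1 - l) * dist μ q ^ 2))) ≤
        Real.exp (-((∑ i, c i : ℕ) * (κ + κ))) := by
      refine Real.exp_le_exp.2 (neg_le_neg (mul_le_mul_of_nonneg_left
        (hκ1.trans (mul_le_mul_of_nonneg_left ?_ hl2.le)) (Nat.cast_nonneg _)))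
      exact pow_le_pow_left₀ hδ.le hfar 2
    refine le_of_mul_le_mul_right ?_ hxL
    calc r * v * ((θ : ℝ) ^ M * (1 - θ) ^ (∑ i, c i)) * likelihood c x
        = v * (r * ((θ : ℝ) ^ M * (1 - θ) ^ (∑ i, c i) * likelihood c x)) := by ring
      _ ≤ v * likelihood c μ := mul_le_mul_of_nonneg_left h1 hv0
      _ ≤ likelihood c q := hv μ
      _ ≤ _ := h2
      _ ≤ _ := mul_le_mul_of_nonneg_right h3 hxL.le

lemma dirichlet_real_univ_pos (c : Fin (M + 1) → ℕ) :
    0 < (dirichlet (fun i => 1 + (c i : ℝ))).real Set.univ := by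
  obtain ⟨θ, hθ0, hθ1, -, -⟩ := exists_unitInterval_exp_le one_pos one_pos
  exact dirichlet_real_pos c θ hθ0 hθ1 _ (likelihood_empirical_pos c) fun _ => Set.mem_univ _

/-- A set on which the likelihood is exponentially small has exponentially small posterior
probability, at any smaller rate. -/
lemma exists_posteriorRatio_univ_le {a a' : ℝ} (ha : a < a') :
    ∃ D : ℝ, 0 ≤ D ∧ ∀ (c : Fin (M + 1) → ℕ) (B : Set (Simplex M)), MeasurableSet B →
      (∀ x ∈ B, likelihood c x ≤
        Real.exp (-((∑ i, c i : ℕ) * a')) * likelihood c (empirical c)) →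
      posteriorRatio c B Set.univ ≤ D * Real.exp (-((∑ i, c i : ℕ) * a)) := by
  obtain ⟨θ, hθ0, hθ1, -, hθ⟩ := exists_unitInterval_exp_le (sub_pos.2 ha) one_pos
  refine ⟨((θ : ℝ) ^ M)⁻¹, by positivity, fun c B hB h => ?_⟩
  have hL := likelihood_empirical_pos c
  have h1 := posteriorRatio_mul_le c hB (by positivity) h θ (empirical c) fun _ => Set.mem_univ _
  refine le_mul_exp_of_mul_le hθ0 hθ (posteriorRatio_nonneg _ _ _) ?_
  rw [sub_add_cancel]
  refine le_of_mul_le_mul_right ?_ hL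
  linarith

end PosteriorBounds

/-! ### The number of plays of a suboptimal arm -/

section Plays

variable {C : Set ℝ} {M K : ℕ} {Ω : Type*} {s : Fin (M + 1) → C} {A : ℕ → Ω → Fin K}
  {X : ℕ → Ω → C} [mΩ : MeasurableSpace Ω] {ρ : ProbabilityMeasure C → ℝ}
  {ν : Fin K → ProbabilityMeasure C} {P : Measure Ω} [IsProbabilityMeasure P]
  {𝓕 : Filtration ℕ mΩ} {L : ℕ → Ω → Fin K → Simplex M}

/-- The count vectors that can occur before round `N`. -/
def countBox (M N : ℕ) : Finset (Fin (M + 1) → ℕ) :=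
  Fintype.piFinset fun _ => Finset.range N

lemma measureReal_le_sum_count {t N : ℕ} (ht : t < N) (k : Fin K) (E : Set Ω) :
    P.real E ≤ ∑ c ∈ countBox M N, P.real ({ω | rewardCount s A X t ω k = c} ∩ E) := by
  refine (measureReal_mono (fun ω hω => ?_) (measure_ne_top _ _)).trans
    (measureReal_biUnion_finset_le _ _)
  refine Set.mem_biUnion (x := rewardCount s A X t ω k) ?_ ⟨rfl, hω⟩
  exact Fintype.mem_piFinset.2 fun i => Finset.mem_range.2 ((rewardCount_le t ω k i).trans_lt ht)

lemma sum_measureReal_le_sum_count (N : ℕ) (k : Fin K) (E : ℕ → Set Ω) :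
    ∑ t ∈ Finset.range N, P.real (E t) ≤ ∑ c ∈ countBox M N,
      ∑ t ∈ Finset.range N, P.real ({ω | rewardCount s A X t ω k = c} ∩ E t) := by
  rw [Finset.sum_comm]
  exact Finset.sum_le_sum fun t ht => measureReal_le_sum_count (Finset.mem_range.1 ht) k (E t)

namespace IsRhoMTS

variable (hrun : IsRhoMTS ρ s ν P 𝓕 L A X)
include hrun

/-- The expected number of plays of an arm while its empirical law is away from its law is
bounded. -/
lemma exists_sum_far_le (hs : Function.Injective s) {p : Fin K → Simplex M}
    (hp : ∀ k, discreteLaw s (p k) = ν k) (k : Fin K) {δ : ℝ} (hδ : 0 < δ) :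
    ∃ D : ℝ, ∀ N, ∑ t ∈ Finset.range N, P.real {ω | A t ω = k ∧
      δ ≤ dist (empirical (rewardCount s A X t ω k)) (p k)} ≤ D := by
  refine ⟨_, fun N => (sum_measureReal_le_sum_count (s := s) (A := A) (X := X) N k
    _).trans ((Finset.sum_le_sum
    fun c _ => ?_).trans (sum_exp_neg_mul_sum_le (M := M) (κ := δ ^ 2 / 4) (by positivity) N))⟩
  by_cases hfar : δ ≤ dist (empirical c) (p k)
  · have h1 : ∑ t ∈ Finset.range N, P.real ({ω | rewardCount s A X t ω k = c} ∩
        {ω | A t ω = k ∧ δ ≤ dist (empirical (rewardCount s A X t ω k)) (p k)}) ≤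
        ∑ t ∈ Finset.range N, P.real ({ω | rewardCount s A X t ω k = c} ∩ {ω | A t ω = k}) :=
      Finset.sum_le_sum fun t _ => measureReal_mono fun ω hω => ⟨hω.1, hω.2.1⟩
    refine h1.trans (le_of_mul_le_mul_right ?_ (likelihood_empirical_pos c))
    exact (hrun.sum_visits_mul_likelihood_le hs hp N k _ c).trans
      (likelihood_le_exp_mul_empirical c (p k) hδ.le hfar)
  · have h1 : ∀ t, {ω | rewardCount s A X t ω k = c} ∩
        {ω | A t ω = k ∧ δ ≤ dist (empirical (rewardCount s A X t ω k)) (p k)} = ∅ := fun t => by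
      refine Set.eq_empty_of_forall_notMem fun ω hω => hfar ?_
      have := hω.2.2
      rwa [show rewardCount s A X t ω k = c from hω.1] at this
    simp only [h1, measureReal_empty, Finset.sum_const_zero]
    positivity

/-- The expected number of rounds in which the largest sampled risk is at most a level below the
risk of arm `j` is bounded. Given the past, such a round is as likely, up to the posterior odds of
arm `j`, as a round in which the sample of arm `j` alone exceeds the level; arm `j` is played in
the latter. -/
lemma exists_sum_sample_le_le (hs : Function.Injective s) {p : Fin K → Simplex M}
    (hp : ∀ k, discreteLaw s (p k) = ν k) (hρ : KSContinuous ρ) (j k : Fin K) {y : ℝ}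
    (hy : y < ρ (ν j)) :
    ∃ D : ℝ, ∀ N, ∑ t ∈ Finset.range N, P.real {ω | K ≤ t ∧ A t ω = k ∧
      ρ (discreteLaw s (L t ω k)) ≤ y} ≤ D := by
  set R : Simplex M → ℝ := fun x => ρ (discreteLaw s x) with hRdef
  have hR : Continuous R := hρ.continuous_risk s
  obtain ⟨κ, hκ, D, hD⟩ := exists_posteriorRatio_mul_le_exp hR (q := p j) (y := y)
    (by simpa only [hRdef, hp j] using hy)
  have hG : MeasurableSet {x | R x ≤ y} := (isClosed_le hR continuous_const).measurableSet
  have hG' : MeasurableSet {x | y < R x} := (isOpen_lt continuous_const hR).measurableSet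
  refine ⟨max D 0 * ((1 - Real.exp (-κ))⁻¹) ^ (M + 1), fun N =>
    (sum_measureReal_le_sum_count (s := s) (A := A) (X := X) N j _).trans
      ((Finset.sum_le_sum fun c _ => ?_).trans
      (((Finset.mul_sum _ _ _).symm.trans_le
        (mul_le_mul_of_nonneg_left (sum_exp_neg_mul_sum_le (M := M) hκ N) (le_max_right D 0)))))⟩
  have hstep : ∀ t, P.real ({ω | rewardCount s A X t ω j = c} ∩
      {ω | K ≤ t ∧ A t ω = k ∧ R (L t ω k) ≤ y}) ≤
      posteriorRatio c {x | R x ≤ y} {x | y < R x} *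
        P.real ({ω | rewardCount s A X t ω j = c} ∩ {ω | A t ω = j}) := fun t => by
    by_cases ht : K ≤ t
    · have harg := hrun.arm_argmax t ht
      calc _ ≤ P.real ({ω | rewardCount s A X t ω j = c} ∩ {ω | ∀ i, L t ω i ∈
              Function.update (fun _ => {x | R x ≤ y}) j {x | R x ≤ y} i}) := by
            refine ENNReal.toReal_mono (measure_ne_top _ _) (measure_mono_ae ?_)
            filter_upwards [harg] with ω hω hE
            obtain ⟨hc, -, hAk, hle⟩ := hE
            refine ⟨hc, fun i => ?_⟩
            rw [Function.update_eq_self]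
            have := hω i
            rw [hAk] at this
            exact this.trans hle
        _ = posteriorRatio c {x | R x ≤ y} {x | y < R x} *
            P.real ({ω | rewardCount s A X t ω j = c} ∩ {ω | ∀ i, L t ω i ∈
              Function.update (fun _ => {x | R x ≤ y}) j {x | y < R x} i}) :=
            hrun.measureReal_sample_update t j c hG hG' hG (hD c).1
        _ ≤ _ := by
            refine mul_le_mul_of_nonneg_left ?_ (posteriorRatio_nonneg _ _ _)
            refine ENNReal.toReal_mono (measure_ne_top _ _) (measure_mono_ae ?_)
            filter_upwards [harg] with ω hω hE
            refine ⟨hE.1, ?_⟩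
            by_contra hA
            have h1 := hE.2 j
            have h2 := hE.2 (A t ω)
            rw [Function.update_self] at h1
            rw [Function.update_of_ne hA] at h2
            exact ((hω j).trans h2).not_gt h1
    · have : {ω | K ≤ t ∧ A t ω = k ∧ R (L t ω k) ≤ y} = ∅ := by
        simp [ht]
      rw [this, Set.inter_empty, measureReal_empty]
      exact mul_nonneg (posteriorRatio_nonneg _ _ _) measureReal_nonneg
  refine (Finset.sum_le_sum fun t _ => hstep t).trans ?_
  rw [← Finset.mul_sum]
  refine ((hD c).2 _ (Finset.sum_nonneg fun _ _ => measureReal_nonneg)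
    (hrun.sum_visits_le_one hs hp N j c)
    fun x => hrun.sum_visits_mul_likelihood_le hs hp N j x c).trans ?_
  exact mul_le_mul_of_nonneg_right (le_max_left _ _) (Real.exp_pos _).le

/-- Once arm `k` has `m` observations and an empirical law close to its law, a sample whose risk is
close to the level `r` or above has probability at most of order `exp (-m a)` in each round, for
every `a < K_inf(ν_k, r)`. -/
lemma exists_sum_near_le (hs : Function.Injective s) {p : Fin K → Simplex M}
    (hp : ∀ k, discreteLaw s (p k) = ν k) (hρ : KSContinuous ρ) (k : Fin K) {r a : ℝ}
    (ha0 : 0 < a) (ha : ENNReal.ofReal a < Kinf ρ s (ν k) r) :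
    ∃ ε > 0, ∃ D : ℝ, ∀ N m : ℕ, ∑ t ∈ Finset.range N, P.real {ω |
      dist (empirical (rewardCount s A X t ω k)) (p k) < ε ∧
      m ≤ ∑ i, rewardCount s A X t ω k i ∧ r - ε < ρ (discreteLaw s (L t ω k))} ≤
      N * (D * Real.exp (-(m * a))) := by
  obtain ⟨a', haa', ha'⟩ : ∃ a', a < a' ∧ ENNReal.ofReal a' < Kinf ρ s (ν k) r := by
    obtain ⟨b, -, hab, hb⟩ := ENNReal.lt_iff_exists_real_btwn.1 ha
    exact ⟨b, (ENNReal.ofReal_lt_ofReal_iff_of_nonneg ha0.le).1 hab, hb⟩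
  rw [← hp k] at ha'
  obtain ⟨ε, hε, hlik⟩ := exists_likelihood_le_of_lt_Kinf hρ hs ha'
  obtain ⟨D, hD0, hD⟩ := exists_posteriorRatio_univ_le (M := M) haa'
  have hR : Continuous fun x : Simplex M => ρ (discreteLaw s x) := hρ.continuous_risk s
  set B : Set (Simplex M) := {x | r - ε < ρ (discreteLaw s x)} with hBdef
  have hB : MeasurableSet B := (isOpen_lt continuous_const hR).measurableSet
  refine ⟨ε, hε, D, fun N m => ?_⟩
  have hround : ∀ t ∈ Finset.range N, P.real {ω |
      dist (empirical (rewardCount s A X t ω k)) (p k) < ε ∧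
      m ≤ ∑ i, rewardCount s A X t ω k i ∧ L t ω k ∈ B} ≤ D * Real.exp (-(m * a)) := by
    intro t ht
    refine (measureReal_le_sum_count (s := s) (A := A) (X := X) (Finset.mem_range.1 ht) k
      _).trans ?_
    have hc : ∀ c ∈ countBox M N, P.real ({ω | rewardCount s A X t ω k = c} ∩ {ω |
        dist (empirical (rewardCount s A X t ω k)) (p k) < ε ∧
        m ≤ ∑ i, rewardCount s A X t ω k i ∧ L t ω k ∈ B}) ≤
        D * Real.exp (-(m * a)) * P.real {ω | rewardCount s A X t ω k = c} := fun c _ => by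
      by_cases h : dist (empirical c) (p k) < ε ∧ m ≤ ∑ i, c i
      · have h1 := hrun.measureReal_sample_update t k c hB MeasurableSet.univ MeasurableSet.univ
          (dirichlet_real_univ_pos c)
        calc _ ≤ P.real ({ω | rewardCount s A X t ω k = c} ∩ {ω | ∀ i, L t ω i ∈
              Function.update (fun _ => Set.univ) k B i}) := by
              refine measureReal_mono fun ω hω => ⟨hω.1, fun i => ?_⟩
              by_cases hi : i = k
              · subst hi
                simpa using hω.2.2.2
              · simp [Function.update_of_ne hi]
          _ = _ := h1
          _ ≤ _ := by
              refine mul_le_mul ((hD c B hB (hlik c h.1)).trans ?_)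
                (measureReal_mono Set.inter_subset_left) measureReal_nonneg (by positivity)
              refine mul_le_mul_of_nonneg_left (Real.exp_le_exp.2 (neg_le_neg ?_)) hD0
              exact mul_le_mul_of_nonneg_right (by exact_mod_cast h.2) ha0.le
      · have : {ω | rewardCount s A X t ω k = c} ∩ {ω |
            dist (empirical (rewardCount s A X t ω k)) (p k) < ε ∧
            m ≤ ∑ i, rewardCount s A X t ω k i ∧ L t ω k ∈ B} = ∅ := by
          refine Set.eq_empty_of_forall_notMem fun ω hω => h ?_
          have h2 := hω.2
          rw [Set.mem_ofPred_eq, show rewardCount s A X t ω k = c from hω.1] at h2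
          exact ⟨h2.1, h2.2.1⟩
        rw [this, measureReal_empty]
        positivity
    refine (Finset.sum_le_sum hc).trans ?_
    rw [← Finset.mul_sum]
    refine mul_le_of_le_one_right (by positivity) ?_
    rw [← measureReal_biUnion_finset]
    · exact measureReal_le_one
    · intro c _ c' _ hcc
      exact Set.disjoint_left.2 fun ω h1 h2 => hcc (h1.symm.trans h2)
    · exact fun c _ => 𝓕.le t _ (hrun.measurableSet_count_eq t k c)
  refine (Finset.sum_le_card_nsmul _ _ _ hround).trans_eq ?_
  rw [Finset.card_range, nsmul_eq_mul]

/-- The expected number of plays of an arm `k` that is worse than the arm `j` is at most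
`log N / a + O(1)`, for every `a < K_inf(ν_k, ρ(ν_j))`. -/
lemma exists_sum_plays_le (hs : Function.Injective s) (hν : ∀ k, ν k ∈ alphabetLaws s)
    (hρ : KSContinuous ρ) (j k : Fin K) {a : ℝ} (ha0 : 0 < a)
    (ha : ENNReal.ofReal a < Kinf ρ s (ν k) (ρ (ν j))) :
    ∃ D : ℝ, ∀ N : ℕ, 1 ≤ N →
      ∑ t ∈ Finset.range N, P.real {ω | A t ω = k} ≤ Real.log N / a + D := by
  choose p hp using hν
  obtain ⟨ε, hε, D₁, hD₁⟩ := hrun.exists_sum_near_le hs hp hρ k ha0 ha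
  obtain ⟨D₂, hD₂⟩ := hrun.exists_sum_far_le hs hp k hε
  obtain ⟨D₃, hD₃⟩ := hrun.exists_sum_sample_le_le hs hp hρ j k (sub_lt_self (ρ (ν j)) hε)
  refine ⟨K + D₃ + D₂ + 1 + max D₁ 0, fun N hN => ?_⟩
  have hN0 : (0 : ℝ) < N := by exact_mod_cast hN
  -- from this number of observations on, the posterior probabilities are of order `1 / N`
  set m := ⌈Real.log N / a⌉₊ with hm
  have hlog : 0 ≤ Real.log N / a := div_nonneg (Real.log_natCast_nonneg N) ha0.le
  have hsplit : ∀ t, P.real {ω | A t ω = k} ≤ (if t < K then 1 else 0) +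
      P.real {ω | K ≤ t ∧ A t ω = k ∧ ρ (discreteLaw s (L t ω k)) ≤ ρ (ν j) - ε} +
      P.real {ω | A t ω = k ∧ ε ≤ dist (empirical (rewardCount s A X t ω k)) (p k)} +
      P.real {ω | A t ω = k ∧ ∑ i, rewardCount s A X t ω k i < m} +
      P.real {ω | dist (empirical (rewardCount s A X t ω k)) (p k) < ε ∧
        m ≤ ∑ i, rewardCount s A X t ω k i ∧ ρ (ν j) - ε < ρ (discreteLaw s (L t ω k))} := by
    intro t
    have h0 : P.real {_ω : Ω | t < K} = if t < K then 1 else 0 := by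
      split_ifs with h <;> simp [h]
    rw [← h0]
    refine le_trans (measureReal_mono fun ω hω => ?_)
      ((measureReal_union_le _ _).trans (add_le_add_left ((measureReal_union_le _ _).trans
        (add_le_add_left ((measureReal_union_le _ _).trans
          (add_le_add_left (measureReal_union_le _ _) _)) _)) _))
    change A t ω = k at hω
    simp only [Set.mem_union, Set.mem_ofPred_eq, hω, true_and]
    by_cases h1 : t < K
    · tauto
    · have h1' := not_lt.1 h1
      by_cases h2 : ρ (discreteLaw s (L t ω k)) ≤ ρ (ν j) - ε
      · tauto
      · have h2' := not_le.1 h2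
        rcases lt_or_ge (dist (empirical (rewardCount s A X t ω k)) (p k)) ε with h3 | h3
        · rcases lt_or_ge (∑ i, rewardCount s A X t ω k i) m with h4 | h4 <;> tauto
        · tauto
  refine (Finset.sum_le_sum fun t _ => hsplit t).trans ?_
  simp only [Finset.sum_add_distrib]
  have e1 : ∑ t ∈ Finset.range N, (if t < K then (1 : ℝ) else 0) ≤ K := by
    rw [← Finset.sum_filter, Finset.sum_const, nsmul_eq_mul, mul_one]
    have : (Finset.range N).filter (· < K) ⊆ Finset.range K := fun t ht =>
      Finset.mem_range.2 (Finset.mem_filter.1 ht).2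
    exact_mod_cast (Finset.card_le_card this).trans_eq (Finset.card_range K)
  have e2 := hrun.sum_measureReal_count_lt_le hs (fun k => ⟨p k, hp k⟩) N m k
  have e3 : (m : ℝ) ≤ Real.log N / a + 1 := (Nat.ceil_lt_add_one hlog).le
  have e4 : (N : ℝ) * (D₁ * Real.exp (-(m * a))) ≤ max D₁ 0 := by
    have h1 : Real.log N ≤ m * a := (div_le_iff₀ ha0).1 (Nat.le_ceil _)
    have h2 : (N : ℝ) * Real.exp (-(m * a)) ≤ 1 := by
      rw [Real.exp_neg, ← div_eq_mul_inv, div_le_one (Real.exp_pos _)]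
      exact (Real.log_le_iff_le_exp hN0).1 h1
    have h3 : 0 ≤ (N : ℝ) * Real.exp (-(m * a)) := by positivity
    calc (N : ℝ) * (D₁ * Real.exp (-(m * a))) = D₁ * (N * Real.exp (-(m * a))) := by ring
      _ ≤ max D₁ 0 * (N * Real.exp (-(m * a))) :=
          mul_le_mul_of_nonneg_right (le_max_left _ _) h3
      _ ≤ max D₁ 0 := mul_le_of_le_one_right (le_max_right _ _) h2
  linarith [hD₁ N m, hD₂ N, hD₃ N]

end IsRhoMTS

end Plays

/-! ### Regret -/

section Regret

variable {C : Set ℝ} {M K : ℕ} {Ω : Type*} {s : Fin (M + 1) → C} {A : ℕ → Ω → Fin K}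
  {X : ℕ → Ω → C} [mΩ : MeasurableSpace Ω] {ρ : ProbabilityMeasure C → ℝ}
  {ν : Fin K → ProbabilityMeasure C} {P : Measure Ω} [IsProbabilityMeasure P]
  {𝓕 : Filtration ℕ mΩ} {L : ℕ → Ω → Fin K → Simplex M}

lemma gap_nonneg (k : Fin K) : 0 ≤ gap ρ ν k :=
  sub_nonneg.2 (le_ciSup (f := fun k => ρ (ν k)) (Set.finite_range _).bddAbove k)

lemma IsRhoMTS.regret_eq (hrun : IsRhoMTS ρ s ν P 𝓕 L A X) (n : ℕ) :
    regret ρ ν P A n =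
      ∑ k with 0 < gap ρ ν k, gap ρ ν k * ∑ t ∈ Finset.range n, P.real {ω | A t ω = k} := by
  classical
  have hpt : ∀ t ω, bestRisk ρ ν - ρ (ν (A t ω)) =
      ∑ k, {ω | A t ω = k}.indicator (fun _ => gap ρ ν k) ω := fun t ω => by
    simp [Set.indicator_apply, gap]
  have hint : ∀ t k, Integrable ({ω | A t ω = k}.indicator fun _ => gap ρ ν k) P := fun t k =>
    (integrable_const _).indicator (hrun.measurableSet_arm_eq t k)
  rw [regret]
  simp_rw [hpt]
  rw [integral_finsetSum _ fun t _ => integrable_finsetSum _ fun k _ => hint t k]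
  have h1 : ∀ t, ∫ ω, ∑ k, {ω | A t ω = k}.indicator (fun _ => gap ρ ν k) ω ∂P =
      ∑ k, gap ρ ν k * P.real {ω | A t ω = k} := fun t => by
    rw [integral_finsetSum _ fun k _ => hint t k]
    refine Finset.sum_congr rfl fun k _ => ?_
    rw [integral_indicator_const _ (hrun.measurableSet_arm_eq t k), smul_eq_mul, mul_comm]
  simp_rw [h1]
  rw [Finset.sum_comm]
  simp_rw [← Finset.mul_sum]
  symm
  refine Finset.sum_subset (Finset.filter_subset _ _) fun k _ hk => ?_
  have : gap ρ ν k = 0 := le_antisymm (by simpa using hk) (gap_nonneg k)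
  rw [this, zero_mul]

lemma ofReal_inv_toReal_add_lt {κ : ℝ≥0∞} (hκ : 0 < κ) {δ : ℝ} (hδ : 0 < δ) :
    ENNReal.ofReal ((κ⁻¹).toReal + δ)⁻¹ < κ := by
  rcases eq_or_ne κ ∞ with rfl | h
  · exact ENNReal.ofReal_lt_top
  · have h0 : 0 < κ.toReal := ENNReal.toReal_pos hκ.ne' h
    rw [ENNReal.ofReal_lt_iff_lt_toReal (by positivity) h, ENNReal.toReal_inv]
    rw [inv_lt_comm₀ (by positivity) h0]
    linarith

end Regret

end RiskMTS

theorem mainTheorem1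
    (C : Set ℝ) (hC : IsCompact C) (hC01 : C ⊆ Set.Icc 0 1)
    (M : ℕ) (s : Fin (M + 1) → C) (hs : Function.Injective s)
    (K : ℕ) [NeZero K] (ν : Fin K → ProbabilityMeasure C) (hν : ∀ k, ν k ∈ alphabetLaws s)
    (ρ : ProbabilityMeasure C → ℝ) (hcont : KSContinuous ρ) (hdom : Dominant ρ)
    (hcard : DominantOn ρ s (fun I => I.card = M))
    (Ω : Type*) [mΩ : MeasurableSpace Ω] (P : Measure Ω) [IsProbabilityMeasure P]
    (𝓕 : Filtration ℕ mΩ) (L : ℕ → Ω → Fin K → Simplex M) (A : ℕ → Ω → Fin K)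
    (X : ℕ → Ω → C) (hrun : IsRhoMTS ρ s ν P 𝓕 L A X) :
    (∀ k, 0 < gap ρ ν k → 0 < Kinf ρ s (ν k) (bestRisk ρ ν)) ∧
    ∃ e : ℕ → ℝ, e =o[atTop] (fun n : ℕ => Real.log n) ∧
      ∀ n : ℕ, regret ρ ν P A n ≤
        (∑ k with 0 < gap ρ ν k,
          gap ρ ν k * Real.log n * ((Kinf ρ s (ν k) (bestRisk ρ ν))⁻¹).toReal) + e n := by
  classical
  obtain ⟨j, hj⟩ : ∃ j, ρ (ν j) = bestRisk ρ ν :=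
    exists_eq_ciSup_of_finite (f := fun k => ρ (ν k))
  have hpos : ∀ k, 0 < gap ρ ν k → 0 < Kinf ρ s (ν k) (bestRisk ρ ν) := fun k hk =>
    hcard.Kinf_pos (hν k) ⟨ν j, hν j, hj.ge⟩ (sub_pos.1 hk)
  refine ⟨hpos, fun n => max 0 (regret ρ ν P A n - ∑ k with 0 < gap ρ ν k,
    gap ρ ν k * Real.log n * ((Kinf ρ s (ν k) (bestRisk ρ ν))⁻¹).toReal), ?_, fun n => ?_⟩
  swap
  · have := le_max_right 0 (regret ρ ν P A n - ∑ k with 0 < gap ρ ν k,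
      gap ρ ν k * Real.log n * ((Kinf ρ s (ν k) (bestRisk ρ ν))⁻¹).toReal)
    linarith
  rw [Asymptotics.isLittleO_iff]
  intro ε hε
  set G : ℝ := ∑ k with 0 < gap ρ ν k, gap ρ ν k with hG
  have hG0 : 0 ≤ G := Finset.sum_nonneg fun k _ => gap_nonneg k
  -- the error `δ` in each rate costs at most `G * δ ≤ ε / 2` in the factor of `log n`
  set δ : ℝ := ε / 2 / (G + 1) with hδ
  have hδ0 : 0 < δ := by positivity
  have hGδ : G * δ ≤ ε / 2 := by
    rw [hδ, mul_div_assoc', div_le_iff₀ (by positivity)]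
    nlinarith
  have hplays : ∀ k, ∃ D : ℝ, 0 < gap ρ ν k → ∀ N : ℕ, 1 ≤ N →
      ∑ t ∈ Finset.range N, P.real {ω | A t ω = k} ≤
        Real.log N * (((Kinf ρ s (ν k) (bestRisk ρ ν))⁻¹).toReal + δ) + D := fun k => by
    by_cases hk : 0 < gap ρ ν k
    · have h1 := ofReal_inv_toReal_add_lt (hpos k hk) hδ0
      have h2 : 0 < ((Kinf ρ s (ν k) (bestRisk ρ ν))⁻¹).toReal + δ := by positivity
      rw [← hj] at h1 h2 ⊢
      obtain ⟨D, hD⟩ := hrun.exists_sum_plays_le hs hν hcont j k (inv_pos.2 h2) h1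
      refine ⟨D, fun _ N hN => ?_⟩
      simpa only [div_inv_eq_mul] using hD N hN
    · exact ⟨0, fun h => absurd h hk⟩
  choose D hD using hplays
  set E : ℝ := ∑ k with 0 < gap ρ ν k, gap ρ ν k * D k with hE
  have hlog : Tendsto (fun n : ℕ => Real.log n) atTop atTop :=
    Real.tendsto_log_atTop.comp tendsto_natCast_atTop_atTop
  filter_upwards [eventually_ge_atTop 1, hlog.eventually_ge_atTop (E / (ε / 2))] with n hn hlarge
  have hlog0 : 0 ≤ Real.log n := Real.log_natCast_nonneg n
  rw [Real.norm_of_nonneg (le_max_left _ _), Real.norm_of_nonneg hlog0]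
  refine max_le (by positivity) ?_
  have hmain : regret ρ ν P A n ≤ (∑ k with 0 < gap ρ ν k,
      gap ρ ν k * Real.log n * ((Kinf ρ s (ν k) (bestRisk ρ ν))⁻¹).toReal) +
      G * δ * Real.log n + E := by
    rw [hrun.regret_eq, hG, hE, Finset.sum_mul, Finset.sum_mul, ← Finset.sum_add_distrib,
      ← Finset.sum_add_distrib]
    refine Finset.sum_le_sum fun k hk => ?_
    have hk' := (Finset.mem_filter.1 hk).2
    have := mul_le_mul_of_nonneg_left (hD k hk' n hn) hk'.le
    linarith
  have h1 : E ≤ ε / 2 * Real.log n := by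
    rw [mul_comm]
    exact (div_le_iff₀ (half_pos hε)).1 hlarge
  have h2 := mul_le_mul_of_nonneg_right hGδ hlog0
  linarith
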